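/- **Definitions.** All algebras are commutative, not necessarily associative, real algebras. *Axes.* For an idempotent $a$ of an algebra $V$ and $\mu\in\mathbb R$ let $V^{(a)}_\mu=\{x\in V: a\cdot x=\mu x\}$. The idempotent $a$ is a (Monster type) *axis* if $V=V^{(a)}_1\oplus V^{(a)}_0\oplus V^{(a)}_{1/4}\oplus V^{(a)}_{1/32}$ and $V^{(a)}_\lambda\cdot V^{(a)}_\mu\subseteq\bigoplus_{\nu\in\lambda*\mu}V^{(a)}_\nu$ for all $\lambda,\mu\in\{1,0,\tfrac14,\tfrac1{32}\}$, where $*$ is the symmetric Monster fusion rule $1*1=\{1\}$, $1*0=\emptyset$, $0*0=\{0\}$, $1*\tfrac14=0*\tfrac14=\{\tfrac14\}$, $\tfrac14*\tfrac14=\{1,0\}$, $\lambda*\tfrac1{32}=\{\tfrac1{32}\}$ for $\lambda\in\{1,0,\tfrac14\}$, $\tfrac1{32}*\tfrac1{32}=\{1,0,\tfrac14\}$. It is *primitive* if $a\neq 0$ and $V_1^{(a)}=\mathbb R a$. A *primitive axial algebra of Monster type* is a pair $(V,A)$ where $A\subseteq V$ is a set of primitive axes generating the algebra $V$. *Majorana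 algebras.* A *Frobenius form* on $(V,A)$ is a non-zero bilinear form with $\langle u,v\cdot w\rangle=\langle u\cdot v,w\rangle$ for all $u,v,w\in V$ and $\langle a,a\rangle=1$ for all $a\in A$. A primitive axial algebra of Monster type $(V,A)$ is a *Majorana algebra* if it has a Frobenius form that is positive definite (symmetric, with $\langle v,v\rangle>0$ for $v\ne0$) and satisfies Norton's inequality $\langle u\cdot u,v\cdot v\rangle\ge\langle u\cdot v,u\cdot v\rangle$ for all $u,v\in V$. *The algebra $M(t)$.* For $t\in\mathbb R$, $M(t)$ is the $12$-dimensional algebra with basis $a_{\pm1},a_{\pm2},a_{\pm3},v_1,v_2,v_3,w_1,w_2,w_3$ (where $v_k=v_{(i,j)}$ for $\{i,j,k\}=\{1,2,3\}$) and the following products, where $\{i,j,k\}=\{1,2,3\}$, $\varepsilon,\delta\in\{1,-1\}$ and $d_i=a_i-a_{-i}$: $$\begin{aligned} a_{\varepsilon i}\cdot a_{\varepsilon i}&=a_{\varepsilon i},\qquad a_i\cdot a_{-i}=0,\qquad v_i\cdot v_i=v_i,\\ a_{\varepsilon i}\cdot a_{\delta j}&=\tfrac1{64}(3a_{\varepsilon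 i}+3a_{\delta j}+a_{-\varepsilon i}+a_{-\delta j}-3v_k),\\ a_{\varepsilon i}\cdot v_k&=\tfrac1{16}(5a_{\varepsilon i}-a_{-\varepsilon i}-2a_j-2a_{-j}+3v_k),\\ a_i\cdot v_i&=w_i,\qquad a_{-i}\cdot v_i=w_i-t\,d_i,\\ a_i\cdot w_i&=\tfrac{3t}4a_i+\tfrac14w_i,\qquad a_{-i}\cdot w_i=-\tfrac t4a_i+\tfrac14w_i,\\ a_{\varepsilon j}\cdot w_i&=-\tfrac{3t}{64}d_i+\tfrac t{16}(2a_{\varepsilon j}+d_k)+\tfrac1{16}(2w_i+a_{\varepsilon j}\cdot v_j-2w_k),\\ v_i\cdot v_j&=-\tfrac{8t}3a_k+\tfrac{2t}3(d_i+d_j)+\tfrac14(v_i+v_j-v_k)+\tfrac43(2w_k-w_i-w_j),\\ v_i\cdot w_i&=\tfrac{(2t-1)t}4d_i+\tfrac t4v_i+\tfrac12w_i,\\ v_k\cdot w_i&=-\tfrac{5t}{48}a_i-\tfrac{11t}{48}a_{-i}-\tfrac{11t}{24}a_j-\tfrac{5t}{24}a_{-j}+\tfrac t8v_k+\tfrac14(w_i+w_j),\\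 w_i\cdot w_i&=\tfrac{(10t+1)t}{16}a_i-\tfrac{(2t-1)t}{16}a_{-i}+\tfrac t{16}v_i+\tfrac t4w_i,\\ w_i\cdot w_j&=\tfrac{t^2}{32}(d_i+d_j)+\tfrac{(2t-1)t}{32}a_k-\tfrac{(2t+1)t}{32}a_{-k}+\tfrac t{64}(v_i+v_j+2v_k)+\tfrac t8(w_i+w_j-w_k). \end{aligned}$$ Let $A=\{a_{\pm1},a_{\pm2},a_{\pm3}\}$, and let $\langle\,,\rangle$ be the symmetric bilinear form on $M(t)$ with, for $i\ne j$, $\langle a_{\varepsilon i},a_{\varepsilon i}\rangle=1$, $\langle a_i,a_{-i}\rangle=0$, $\langle a_{\varepsilon i},a_{\delta j}\rangle=\tfrac1{32}$, $\langle a_{\varepsilon i},v_i\rangle=t$, $\langle a_{\varepsilon i},v_j\rangle=\tfrac38$, $\langle a_i,w_i\rangle=t$, $\langle a_{-i},w_i\rangle=0$, $\langle a_{\varepsilon j},w_i\rangle=\tfrac{3t}{16}$, $\langle v_i,v_i\rangle=2$, $\langle v_i,v_j\rangle=\tfrac12-\tfrac{8t}3$, $\langle v_i,w_i\rangle=t$,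 $\langle v_j,w_i\rangle=-\tfrac t4$, $\langle w_i,w_i\rangle=\tfrac{(3t+1)t}4$, $\langle w_i,w_j\rangle=\tfrac{(2t+1)t}{16}$. **Theorem.** Let $t\in\mathbb R$. Then $(M(t),A)$ is a primitive axial algebra of Monster type and $\langle\,,\rangle$ is a Frobenius form on it. Moreover: 1. $(M(t),A)$ is a Majorana algebra if and only if $0<t<\tfrac16$. 2. If $t\in\{0,\tfrac16\}$, then the radical $M(t)^\perp=\{u:\langle u,v\rangle=0\text{ for all }v\in M(t)\}$ is a $3$-dimensional ideal, and the quotient algebra $M(t)/M(t)^\perp$, with the image of $A$ as its set of axes, is a $9$-dimensional Majorana algebra. -/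

import Mathlib

noncomputable section

namespace MonsterAxial

/-! ### Axial algebras over `ℝ`

Throughout, a commutative, not necessarily associative (nor unital) real algebra is a
`NonUnitalNonAssocCommRing V` with a compatible `ℝ`-module structure. -/

/-- A fusion rule: a set of eigenvalues in `R` (enumerated injectively by `Idx`) with a
symmetric map sending two eigenvalues to a set of eigenvalues. -/
structure FusionRule (R : Type*) where
  Idx : Type
  val : Idx → R
  val_injective : Function.Injective val
  op : Idx → Idx → Set Idx
  op_comm : ∀ i j, op i j = op j i

/-- Names of the four eigenvalues `1`, `0`, `1/4`, `1/32` of the Monster fusion rule. -/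
inductive MonsterIdx : Type
  | one | zero | quarter | thirtysecond

namespace MonsterIdx

/-- The eigenvalue with a given name. -/
def val : MonsterIdx → ℝ
  | one => 1
  | zero => 0
  | quarter => 1 / 4
  | thirtysecond => 1 / 32

/-- The table of the Monster fusion rule. -/
def op : MonsterIdx → MonsterIdx → Set MonsterIdx
  | one, one => {one}
  | one, zero => ∅
  | one, quarter => {quarter}
  | one, thirtysecond => {thirtysecond}
  | zero, one => ∅
  | zero, zero => {zero}
  | zero, quarter => {quarter}
  | zero, thirtysecond => {thirtysecond}
  | quarter, one => {quarter}
  | quarter, zero => {quarter}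
  | quarter, quarter => {one, zero}
  | quarter, thirtysecond => {thirtysecond}
  | thirtysecond, one => {thirtysecond}
  | thirtysecond, zero => {thirtysecond}
  | thirtysecond, quarter => {thirtysecond}
  | thirtysecond, thirtysecond => {one, zero, quarter}

end MonsterIdx

/-- The Monster (or Majorana) fusion rule over `ℝ`. -/
def monster : FusionRule ℝ where
  Idx := MonsterIdx
  val := MonsterIdx.val
  val_injective := by
    intro i j h
    cases i <;> cases j <;> first | rfl | (norm_num [MonsterIdx.val] at h)
  op := MonsterIdx.op
  op_comm := by
    intro i j
    cases i <;> cases j <;> rfl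

section Axial

variable {V : Type*} [NonUnitalNonAssocCommRing V] [Module ℝ V]
  [SMulCommClass ℝ V V] [IsScalarTower ℝ V V]

/-- The `μ`-eigenspace `{v | a * v = μ • v}` of the adjoint action of `a`. -/
def adEigenspace (a : V) (μ : ℝ) : Submodule ℝ V :=
  Module.End.eigenspace (LinearMap.mulLeft ℝ a) μ

/-- The sum of the eigenspaces of `a` over a set of eigenvalues of a fusion rule
(eigenspaces for distinct eigenvalues are independent, so this sum is direct). -/
def adEigenspaces (F : FusionRule ℝ) (a : V) (S : Set F.Idx) : Submodule ℝ V :=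
  ⨆ i ∈ S, adEigenspace a (F.val i)

/-- `a` is an axis for the fusion rule `F`. -/
structure IsAxis (F : FusionRule ℝ) (a : V) : Prop where
  idem : a * a = a
  decomp : adEigenspaces F a Set.univ = ⊤
  fusion : ∀ i j : F.Idx, ∀ x ∈ adEigenspace a (F.val i), ∀ y ∈ adEigenspace a (F.val j),
    x * y ∈ adEigenspaces F a (F.op i j)

/-- The `1`-eigenspace of `a` is one-dimensional, spanned by `a`. -/
def IsPrimitive (a : V) : Prop :=
  a ≠ 0 ∧ adEigenspace a 1 = Submodule.span ℝ {a}

/-- `(V, A)` is a primitive axial algebra for the fusion rule `F`. -/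
structure IsPrimitiveAxialAlgebra (F : FusionRule ℝ) (A : Set V) : Prop where
  isAxis : ∀ a ∈ A, IsAxis F a
  isPrimitive : ∀ a ∈ A, IsPrimitive a
  generates : NonUnitalAlgebra.adjoin ℝ A = ⊤

/-- A Frobenius form on `(V, A)`: non-zero, associating, and normalised by `⟨a, a⟩ = 1` on
the axes. -/
structure IsFrobeniusForm (A : Set V) (B : LinearMap.BilinForm ℝ V) : Prop where
  ne_zero : B ≠ 0
  assoc : ∀ u v w : V, B u (v * w) = B (u * v) w
  norm_axis : ∀ a ∈ A, B a a = 1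

/-- Positive definiteness of a (symmetric) bilinear form. -/
def IsPositiveDefinite (B : LinearMap.BilinForm ℝ V) : Prop :=
  (∀ u v : V, B u v = B v u) ∧ ∀ v : V, v ≠ 0 → 0 < B v v

/-- Norton's inequality. -/
def NortonInequality (B : LinearMap.BilinForm ℝ V) : Prop :=
  ∀ u v : V, B (u * v) (u * v) ≤ B (u * u) (v * v)

/-- `(V, A)` is a Majorana algebra: a primitive axial algebra of Monster type with a Frobenius
form which is positive definite and satisfies Norton's inequality. -/
def IsMajoranaAlgebra (A : Set V) : Prop :=
  IsPrimitiveAxialAlgebra monster A ∧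
    ∃ B : LinearMap.BilinForm ℝ V,
      IsFrobeniusForm A B ∧ IsPositiveDefinite B ∧ NortonInequality B

end Axial

/-! ### Ideals and quotient algebras -/

/-- An ideal of a commutative non-associative real algebra. -/
structure AlgIdeal (V : Type*) [NonUnitalNonAssocCommRing V] [Module ℝ V]
    extends Submodule ℝ V where
  mul_mem' : ∀ (v : V) {x : V}, x ∈ carrier → v * x ∈ carrier

namespace AlgIdeal

variable {V : Type*} [NonUnitalNonAssocCommRing V] [Module ℝ V] (I : AlgIdeal V)

/-- The quotient of an algebra by an ideal; the vector space `V ⧸ I` with the induced product. -/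
def Quotient : Type _ := V ⧸ I.toSubmodule

instance : AddCommGroup I.Quotient := inferInstanceAs (AddCommGroup (V ⧸ I.toSubmodule))
instance : Module ℝ I.Quotient := inferInstanceAs (Module ℝ (V ⧸ I.toSubmodule))

/-- The projection onto the quotient. -/
def proj : V →ₗ[ℝ] I.Quotient := I.toSubmodule.mkQ

theorem proj_surjective : Function.Surjective I.proj := I.toSubmodule.mkQ_surjective

theorem proj_eq_proj {x y : V} : I.proj x = I.proj y ↔ x - y ∈ I.toSubmodule :=
  Submodule.Quotient.eq I.toSubmodule

instance : Mul I.Quotient where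
  mul := Quotient.map₂ (· * ·) (by
    intro x x' hx y y' hy
    have hx' : x - x' ∈ I.toSubmodule := (Submodule.quotientRel_def _).1 hx
    have hy' : y - y' ∈ I.toSubmodule := (Submodule.quotientRel_def _).1 hy
    refine (Submodule.quotientRel_def _).2 ?_
    have h : x * y - x' * y' = y * (x - x') + x' * (y - y') := by
      rw [mul_sub, mul_sub, mul_comm y x, mul_comm y x']
      abel
    rw [h]
    exact I.toSubmodule.add_mem (I.mul_mem' _ hx') (I.mul_mem' _ hy'))

theorem proj_mul (x y : V) : I.proj (x * y) = I.proj x * I.proj y := rfl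

instance : NonUnitalNonAssocCommRing I.Quotient where
  left_distrib x y z := by
    obtain ⟨x, rfl⟩ := I.proj_surjective x
    obtain ⟨y, rfl⟩ := I.proj_surjective y
    obtain ⟨z, rfl⟩ := I.proj_surjective z
    simp only [← map_add, ← proj_mul, mul_add]
  right_distrib x y z := by
    obtain ⟨x, rfl⟩ := I.proj_surjective x
    obtain ⟨y, rfl⟩ := I.proj_surjective y
    obtain ⟨z, rfl⟩ := I.proj_surjective z
    simp only [← map_add, ← proj_mul, add_mul]
  zero_mul x := by
    obtain ⟨x, rfl⟩ := I.proj_surjective x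
    rw [← map_zero I.proj, ← proj_mul, zero_mul]
  mul_zero x := by
    obtain ⟨x, rfl⟩ := I.proj_surjective x
    rw [← map_zero I.proj, ← proj_mul, mul_zero]
  mul_comm x y := by
    obtain ⟨x, rfl⟩ := I.proj_surjective x
    obtain ⟨y, rfl⟩ := I.proj_surjective y
    rw [← proj_mul, ← proj_mul, mul_comm]

instance [SMulCommClass ℝ V V] : SMulCommClass ℝ I.Quotient I.Quotient where
  smul_comm r x y := by
    obtain ⟨x, rfl⟩ := I.proj_surjective x
    obtain ⟨y, rfl⟩ := I.proj_surjective y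
    simp only [smul_eq_mul, ← map_smul, ← proj_mul, mul_smul_comm]

instance [IsScalarTower ℝ V V] : IsScalarTower ℝ I.Quotient I.Quotient where
  smul_assoc r x y := by
    obtain ⟨x, rfl⟩ := I.proj_surjective x
    obtain ⟨y, rfl⟩ := I.proj_surjective y
    simp only [smul_eq_mul, ← map_smul, ← proj_mul, smul_mul_assoc]

end AlgIdeal

/-- The radical `{u | ⟨u, v⟩ = 0 for all v}` of a Frobenius form, as an ideal. -/
def IsFrobeniusForm.radical {V : Type*} [NonUnitalNonAssocCommRing V] [Module ℝ V]
    {A : Set V} {B : LinearMap.BilinForm ℝ V} (hB : IsFrobeniusForm A B) : AlgIdeal V where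
  toSubmodule := LinearMap.ker B
  mul_mem' := by
    intro v x hx
    have hx' : B x = 0 := hx
    change B (v * x) = 0
    ext y
    rw [mul_comm, ← hB.assoc, hx']
    rfl

/-! ### The algebra `M(t)` -/

/-- Labels of the basis of `M(t)`. The index set `{1, 2, 3}` is `Fin 3`; `a i true` is `a_i`,
`a i false` is `a_{-i}`; for `{i, j, k} = {1, 2, 3}`, `v k` is the vector `v_{(i,j)}` and
`w k` is the vector `a_k · v_{(i,j)}`. -/
inductive Label : Type
  | a (i : Fin 3) (s : Bool)
  | v (k : Fin 3)
  | w (k : Fin 3)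
  deriving DecidableEq, Fintype

/-- For `i ≠ j` in `Fin 3`, the third index. -/
def third (i j : Fin 3) : Fin 3 := -(i + j)

/-- The underlying space of `M(t)`: the real vector space with basis `Label`. -/
def M (_t : ℝ) : Type := Label → ℝ

namespace M

variable (t : ℝ)

instance : AddCommGroup (M t) := inferInstanceAs (AddCommGroup (Label → ℝ))
instance : Module ℝ (M t) := inferInstanceAs (Module ℝ (Label → ℝ))

/-- The basis vector with a given label. -/
def e (p : Label) : M t := (Pi.single p 1 : Label → ℝ)

/-- `a_i` for `s = true` and `a_{-i}` for `s = false`. -/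
abbrev a (i : Fin 3) (s : Bool) : M t := e t (.a i s)

/-- `v_{(i,j)}` where `{i, j, k} = {1, 2, 3}`. -/
abbrev v (k : Fin 3) : M t := e t (.v k)

/-- `a_k · v_{(i,j)}` where `{i, j, k} = {1, 2, 3}`. -/
abbrev w (k : Fin 3) : M t := e t (.w k)

/-- `d_i = a_i - a_{-i}`. -/
abbrev d (i : Fin 3) : M t := a t i true - a t i false

/-- Products of two axes (dihedral algebras of type `2B` and `4A`). -/
def mulAA (i : Fin 3) (s : Bool) (j : Fin 3) (r : Bool) : M t :=
  if i = j then (if s = r then a t i s else 0)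
  else (1 / 64 : ℝ) • ((3 : ℝ) • a t i s + (3 : ℝ) • a t j r + a t i (!s) + a t j (!r)
    - (3 : ℝ) • v t (third i j))

/-- Products of `a_{±i}` with `v k`. For `i = k` they are `a_k · v_{(i,j)} = w k` and
`a_{-k} · v_{(i,j)} = w k - t (a_k - a_{-k})`; otherwise they come from the `4A` algebra. -/
def mulAV (i : Fin 3) (s : Bool) (k : Fin 3) : M t :=
  if i = k then (if s then w t k else w t k - t • d t k)
  else (1 / 16 : ℝ) • ((5 : ℝ) • a t i s - a t i (!s)
    - (2 : ℝ) • (a t (third i k) true + a t (third i k) false) + (3 : ℝ) • v t k)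

/-- Products of `a_{±j}` with `w i`. -/
def mulAW (j : Fin 3) (s : Bool) (i : Fin 3) : M t :=
  if j = i then
    (if s then (3 * t / 4) • a t i true + (1 / 4 : ℝ) • w t i
      else (-t / 4) • a t i true + (1 / 4 : ℝ) • w t i)
  else (-3 * t / 64) • d t i + (t / 16) • ((2 : ℝ) • a t j s + d t (third i j))
    + (1 / 16 : ℝ) • ((2 : ℝ) • w t i + mulAV t j s j - (2 : ℝ) • w t (third i j))

/-- Products of `v i` with `v j`. For `i ≠ j` and `k` the third index, these are
`v_{(j,k)} · v_{(i,k)}`. -/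
def mulVV (i j : Fin 3) : M t :=
  if i = j then v t i
  else (-8 * t / 3) • a t (third i j) true + (2 * t / 3) • (d t i + d t j)
    + (1 / 4 : ℝ) • (v t i + v t j - v t (third i j))
    + (4 / 3 : ℝ) • ((2 : ℝ) • w t (third i j) - (w t i + w t j))

/-- Products of `v k` with `w i`. For `k ≠ i` and `j` the third index, this is
`v_{(i,j)} · (a_i · v_{(j,k)})`. -/
def mulVW (k i : Fin 3) : M t :=
  if k = i then ((2 * t - 1) * t / 4) • d t i + (t / 4) • v t i + (1 / 2 : ℝ) • w t i
  else (-5 * t / 48) • a t i true + (-11 * t / 48) • a t i false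
    + (-11 * t / 24) • a t (third k i) true + (-5 * t / 24) • a t (third k i) false
    + (t / 8) • v t k + (1 / 4 : ℝ) • (w t i + w t (third k i))

/-- Products of `w i` with `w j`. -/
def mulWW (i j : Fin 3) : M t :=
  if i = j then ((10 * t + 1) * t / 16) • a t i true - ((2 * t - 1) * t / 16) • a t i false
    + (t / 16) • v t i + (t / 4) • w t i
  else (t ^ 2 / 32) • (d t i + d t j)
    + ((2 * t - 1) * t / 32) • a t (third i j) true
    - ((2 * t + 1) * t / 32) • a t (third i j) false
    + (t / 64) • (v t i + v t j + (2 : ℝ) • v t (third i j))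
    + (t / 8) • (w t i + w t j - w t (third i j))

/-- The multiplication table of `M(t)`. -/
def basisMul : Label → Label → M t
  | .a i s, .a j r => mulAA t i s j r
  | .a i s, .v k => mulAV t i s k
  | .v k, .a i s => mulAV t i s k
  | .a j s, .w i => mulAW t j s i
  | .w i, .a j s => mulAW t j s i
  | .v i, .v j => mulVV t i j
  | .v k, .w i => mulVW t k i
  | .w i, .v k => mulVW t k i
  | .w i, .w j => mulWW t i j

theorem third_comm (i j : Fin 3) : third i j = third j i := by
  simp only [third, add_comm]

theorem basisMul_comm (p q : Label) : basisMul t p q = basisMul t q p := by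
  rcases p with ⟨i, s⟩ | i | i <;> rcases q with ⟨j, r⟩ | j | j <;>
    simp only [basisMul]
  · by_cases h : i = j
    · subst h
      by_cases h' : s = r
      · subst h'; rfl
      · simp [mulAA, h', Ne.symm h']
    · simp only [mulAA, h, Ne.symm h, if_false, third_comm j i]
      module
  · by_cases h : i = j
    · subst h; rfl
    · simp only [mulVV, h, Ne.symm h, if_false, third_comm j i]
      module
  · by_cases h : i = j
    · subst h; rfl
    · simp only [mulWW, h, Ne.symm h, if_false, third_comm j i]
      module

/-- The product of `M(t)`: the bilinear extension of the multiplication table. -/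
instance : Mul (M t) where
  mul x y := ∑ p : Label, ∑ q : Label, (x p * y q) • basisMul t p q

theorem mul_def (x y : M t) :
    x * y = ∑ p : Label, ∑ q : Label, (x p * y q) • basisMul t p q := rfl

theorem add_apply (x y : M t) (p : Label) : (x + y) p = x p + y p := rfl
theorem zero_apply (p : Label) : (0 : M t) p = 0 := rfl
theorem smul_apply (c : ℝ) (x : M t) (p : Label) : (c • x) p = c * x p := rfl

instance : NonUnitalNonAssocCommRing (M t) where
  left_distrib x y z := by
    simp only [mul_def, add_apply, mul_add, add_smul, Finset.sum_add_distrib]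
  right_distrib x y z := by
    simp only [mul_def, add_apply, add_mul, add_smul, Finset.sum_add_distrib]
  zero_mul x := by simp [mul_def, zero_apply]
  mul_zero x := by simp [mul_def, zero_apply]
  mul_comm x y := by
    rw [mul_def, mul_def, Finset.sum_comm]
    refine Finset.sum_congr rfl fun p _ => Finset.sum_congr rfl fun q _ => ?_
    rw [basisMul_comm, mul_comm]

instance : SMulCommClass ℝ (M t) (M t) where
  smul_comm c x y := by
    simp only [smul_eq_mul, mul_def, smul_apply, Finset.smul_sum, smul_smul, mul_left_comm]

instance : IsScalarTower ℝ (M t) (M t) where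
  smul_assoc c x y := by
    simp only [smul_eq_mul, mul_def, smul_apply, Finset.smul_sum, smul_smul, mul_assoc]

/-- The six axes `a_{±1}`, `a_{±2}`, `a_{±3}`. -/
def axes : Set (M t) := {x | ∃ (i : Fin 3) (s : Bool), x = a t i s}

/-- Values of the form on pairs `(a_{±j}, w i)`. -/
def gramAW (j : Fin 3) (s : Bool) (i : Fin 3) : ℝ :=
  if j = i then (if s then t else 0) else 3 * t / 16

/-- The Gram matrix of the form of `M(t)`. -/
def gram : Label → Label → ℝ
  | .a i s, .a j r => if i = j then (if s = r then 1 else 0) else 1 / 32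
  | .a i _, .v k => if i = k then t else 3 / 8
  | .v k, .a i _ => if i = k then t else 3 / 8
  | .a j s, .w i => gramAW t j s i
  | .w i, .a j s => gramAW t j s i
  | .v i, .v j => if i = j then 2 else 1 / 2 - 8 * t / 3
  | .v k, .w i => if k = i then t else -t / 4
  | .w i, .v k => if k = i then t else -t / 4
  | .w i, .w j => if i = j then (3 * t + 1) * t / 4 else (2 * t + 1) * t / 16

/-- The bilinear form of `M(t)`. -/
def form : LinearMap.BilinForm ℝ (M t) :=
  LinearMap.mk₂ ℝ (fun x y : M t => ∑ p : Label, ∑ q : Label, x p * y q * gram t p q)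
    (fun x x' y => by simp only [add_apply, add_mul, Finset.sum_add_distrib])
    (fun c x y => by
      simp only [smul_apply, smul_eq_mul, Finset.mul_sum, mul_assoc])
    (fun x y y' => by simp only [add_apply, mul_add, add_mul, Finset.sum_add_distrib])
    (fun c x y => by
      simp only [smul_apply, smul_eq_mul, Finset.mul_sum, mul_assoc, mul_left_comm])

end M

end MonsterAxial

end

set_option linter.unusedSimpArgs false
set_option linter.unusedSectionVars false

noncomputable section

namespace MonsterAxial

namespace M

variable (t : ℝ)

/-! The parameter `c t = 1 - 12 * t` and the basis `S`, `D`, `R`, `N` expose a Jordan algebra inside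
M(t). The span of `S`, `R`, `N` is closed under multiplication and maps to complex 3×3 matrices with
the twisted product (XgY + YgX)/2. Here g is the Gram matrix of three unit vectors with cyclic inner
products ω/4, and c = (ω³ + ω⁻³)/2. Each S_i goes to the matrix unit E_ii. The D_i are adjoined as
mutually orthogonal square roots: D_i² = S_i, D_i D_j = 0, and an even x multiplies D_i by the
scalar ⟨S_i, x⟩/2.

Axes: a_{±i} = (S_i ± D_i)/2. On the even part S_i has eigenvalues 1, 0, 1/2 and obeys the Peirce
fusion rules of an idempotent in a Jordan algebra. D_i kills the 0- and 1/2-eigenvectors, so the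
axes act on them with eigenvalues 0 and 1/4. The other two D_j span the 1/32-eigenspace
(`isAxis_a`).

Form: ⟨x, y⟩ is twice the trace of the product of the matrices plus twice the dot product of the
D-coordinates (`form_eq_trace`). This makes ⟨u, vw⟩ a symmetric trilinear expression
(`form_mul_eq_trace`), which gives associativity for every t, since ω exists over ℂ.

Majorana: 0 ≤ t ≤ 1/6 means |c| ≤ 1, so ω can be taken on the unit circle. Then g is positive
definite, g = KᴴK, and X ↦ KXKᴴ turns the model into Hermitian matrices with the ordinary Jordan
product (`exists_hermitian_model`). Positivity is that of the trace form. Norton's inequality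
follows from a commutator and a variance estimate (`norton_hermitian`). The kernel of the model on
the even part is nonzero only when c² = 1, and then the radical is spanned by the three `N`
(`ker_form`). Conversely the Frobenius form is unique, and ⟨N_0, N_0⟩ = 15(1 - c²)/4 > 0 forces 0 <
t < 1/6. -/

theorem e_apply (p q : Label) : e t p q = if q = p then 1 else 0 := by
  rw [e, Pi.single_apply]

theorem e_mul_e (p q : Label) : e t p * e t q = basisMul t p q := by
  rw [mul_def, Finset.sum_eq_single p, Finset.sum_eq_single q]
  · simp [e_apply]
  · intro b _ hb; simp [e_apply, hb]
  · simp
  · intro b _ hb; simp [e_apply, hb]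
  · simp

theorem form_apply (x y : M t) :
    form t x y = ∑ p : Label, ∑ q : Label, x p * y q * gram t p q := rfl

theorem form_e_e (p q : Label) : form t (e t p) (e t q) = gram t p q := by
  rw [form_apply, Finset.sum_eq_single p, Finset.sum_eq_single q]
  · simp [e_apply]
  · intro b _ hb; simp [e_apply, hb]
  · simp
  · intro b _ hb; simp [e_apply, hb]
  · simp

/-! ### The adapted basis `S`, `D`, `R`, `N` and its multiplication table. -/

/-- Positions relative to `i` exploit the cyclic symmetry: each table entry below needs three cases
with `i` left generic, instead of nine. -/
theorem fin_three_cases (i j : Fin 3) : j = i ∨ j = i + 1 ∨ j = i + 2 := by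
  revert i j; decide

theorem third_self_add_one (i : Fin 3) : third i (i + 1) = i + 2 := by revert i; decide
theorem third_self_add_two (i : Fin 3) : third i (i + 2) = i + 1 := by revert i; decide
theorem third_add_one_self (i : Fin 3) : third (i + 1) i = i + 2 := by revert i; decide
theorem third_add_two_self (i : Fin 3) : third (i + 2) i = i + 1 := by revert i; decide
theorem third_add_one_add_two (i : Fin 3) : third (i + 1) (i + 2) = i := by revert i; decide
theorem third_add_two_add_one (i : Fin 3) : third (i + 2) (i + 1) = i := by revert i; decide

/-- The parameter in which the structure constants of `M t` in the basis `S, D, R, N` are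
polynomial. -/
def c : ℝ := 1 - 12 * t

def S (i : Fin 3) : M t := a t i true + a t i false
def D (i : Fin 3) : M t := d t i
-- Normalised so that the product of two different `S` is 1/8 of the third `R`; in the matrix model
-- it is an off-diagonal matrix with entries ω and ω⁻¹.
def R (i : Fin 3) : M t := S t (i + 1) + S t (i + 2) - (3 / 2 : ℝ) • v t i
-- The companion of `R i` at the same off-diagonal positions. Its matrix entries carry the factor
-- (ω³ - ω⁻³)/2, a square root of c² - 1, so it dies in the model exactly when c² = 1.
def N (i : Fin 3) : M t :=
  (12 : ℝ) • (w t (i + 1) + w t (i + 2) - w t i - (t / 2) • (D t (i + 1) + D t (i + 2) - D t i))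
    + (18 * t) • v t i - (12 * t) • (S t (i + 1) + S t (i + 2))

theorem S_mul_S (i j : Fin 3) :
    S t i * S t j = if j = i then S t i else (1 / 8 : ℝ) • R t (third i j) := by
  obtain rfl | rfl | rfl := fin_three_cases i j <;>
  simp [S, D, R, N, e_mul_e, basisMul, mulAA, mulAV, mulAW, mulVV, mulVW, mulWW,
    mul_add, add_mul, mul_sub, sub_mul, add_assoc, third_self_add_one, third_self_add_two,
    third_add_one_self, third_add_two_self, third_add_one_add_two, third_add_two_add_one] <;>
  module

end M

namespace M

variable (t : ℝ)

theorem S_mul_D (i j : Fin 3) :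
    S t i * D t j =
      if j = i then D t j else (1 / 16 : ℝ) • D t j := by
  obtain rfl | rfl | rfl := fin_three_cases i j <;>
  simp only [S, D, R, N, smul_mul_assoc, mul_smul_comm, mul_add, add_mul, mul_sub, sub_mul,
    e_mul_e, basisMul] <;>
  simp [mulAA, mulAV, mulAW, mulVV, mulVW, mulWW, add_assoc, third_self_add_one,
    third_self_add_two, third_add_one_self, third_add_two_self, third_add_one_add_two,
    third_add_two_add_one, c, S, D, R, N] <;>
  module

theorem S_mul_R (i j : Fin 3) :
    S t i * R t j =
      if j = i then (c t / 8) • (R t (i + 1) + R t (i + 2))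
        - (1 / 8 : ℝ) • (N t (i + 1) + N t (i + 2))
      else (1 / 4 : ℝ) • S t i + (1 / 2 : ℝ) • R t j := by
  obtain rfl | rfl | rfl := fin_three_cases i j <;>
  simp only [S, D, R, N, smul_mul_assoc, mul_smul_comm, mul_add, add_mul, mul_sub, sub_mul,
    e_mul_e, basisMul] <;>
  simp [mulAA, mulAV, mulAW, mulVV, mulVW, mulWW, add_assoc, third_self_add_one,
    third_self_add_two, third_add_one_self, third_add_two_self, third_add_one_add_two,
    third_add_two_add_one, c, S, D, R, N] <;>
  module

theorem S_mul_N (i j : Fin 3) :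
    S t i * N t j =
      if j = i then ((c t ^ 2 - 1) / 8) • (R t (i + 1) + R t (i + 2))
        - (c t / 8) • (N t (i + 1) + N t (i + 2))
      else (1 / 2 : ℝ) • N t j := by
  obtain rfl | rfl | rfl := fin_three_cases i j <;>
  simp only [S, D, R, N, smul_mul_assoc, mul_smul_comm, mul_add, add_mul, mul_sub, sub_mul,
    e_mul_e, basisMul] <;>
  simp [mulAA, mulAV, mulAW, mulVV, mulVW, mulWW, add_assoc, third_self_add_one,
    third_self_add_two, third_add_one_self, third_add_two_self, third_add_one_add_two,
    third_add_two_add_one, c, S, D, R, N] <;>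
  module

theorem D_mul_D (i j : Fin 3) :
    D t i * D t j =
      if j = i then S t i else 0 := by
  obtain rfl | rfl | rfl := fin_three_cases i j <;>
  simp only [S, D, R, N, smul_mul_assoc, mul_smul_comm, mul_add, add_mul, mul_sub, sub_mul,
    e_mul_e, basisMul] <;>
  simp [mulAA, mulAV, mulAW, mulVV, mulVW, mulWW, add_assoc, third_self_add_one,
    third_self_add_two, third_add_one_self, third_add_two_self, third_add_one_add_two,
    third_add_two_add_one, c, S, D, R, N] <;>
  module

theorem D_mul_R (i j : Fin 3) :
    D t i * R t j =
      if j = i then (c t / 8) • D t i else (1 / 2 : ℝ) • D t i := by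
  obtain rfl | rfl | rfl := fin_three_cases i j <;>
  simp only [S, D, R, N, smul_mul_assoc, mul_smul_comm, mul_add, add_mul, mul_sub, sub_mul,
    e_mul_e, basisMul] <;>
  simp [mulAA, mulAV, mulAW, mulVV, mulVW, mulWW, add_assoc, third_self_add_one,
    third_self_add_two, third_add_one_self, third_add_two_self, third_add_one_add_two,
    third_add_two_add_one, c, S, D, R, N] <;>
  module

theorem D_mul_N (i j : Fin 3) :
    D t i * N t j =
      if j = i then ((c t ^ 2 - 1) / 8) • D t i else 0 := by
  obtain rfl | rfl | rfl := fin_three_cases i j <;>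
  simp only [S, D, R, N, smul_mul_assoc, mul_smul_comm, mul_add, add_mul, mul_sub, sub_mul,
    e_mul_e, basisMul] <;>
  simp [mulAA, mulAV, mulAW, mulVV, mulVW, mulWW, add_assoc, third_self_add_one,
    third_self_add_two, third_add_one_self, third_add_two_self, third_add_one_add_two,
    third_add_two_add_one, c, S, D, R, N] <;>
  module

theorem R_mul_R (i j : Fin 3) :
    R t i * R t j =
      if j = i then S t (i + 1) + S t (i + 2) + (1 / 4 : ℝ) • R t i
      else (c t / 4) • S t (third i j) + (1 / 8 : ℝ) • (R t i + R t j)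
        + (c t / 2) • R t (third i j) - (1 / 2 : ℝ) • N t (third i j) := by
  obtain rfl | rfl | rfl := fin_three_cases i j <;>
  simp only [S, D, R, N, smul_mul_assoc, mul_smul_comm, mul_add, add_mul, mul_sub, sub_mul,
    e_mul_e, basisMul] <;>
  simp [mulAA, mulAV, mulAW, mulVV, mulVW, mulWW, add_assoc, third_self_add_one,
    third_self_add_two, third_add_one_self, third_add_two_self, third_add_one_add_two,
    third_add_two_add_one, c, S, D, R, N] <;>
  module

theorem R_mul_N (i j : Fin 3) :
    R t i * N t j =
      if j = i then (1 / 4 : ℝ) • N t i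
      else ((c t ^ 2 - 1) / 4) • S t (third i j) + ((c t ^ 2 - 1) / 2) • R t (third i j)
        + (1 / 8 : ℝ) • (N t j - N t i) - (c t / 2) • N t (third i j) := by
  obtain rfl | rfl | rfl := fin_three_cases i j <;>
  simp only [S, D, R, N, smul_mul_assoc, mul_smul_comm, mul_add, add_mul, mul_sub, sub_mul,
    e_mul_e, basisMul] <;>
  simp [mulAA, mulAV, mulAW, mulVV, mulVW, mulWW, add_assoc, third_self_add_one,
    third_self_add_two, third_add_one_self, third_add_two_self, third_add_one_add_two,
    third_add_two_add_one, c, S, D, R, N] <;>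
  module

set_option maxHeartbeats 1000000 in
theorem N_mul_N (i j : Fin 3) :
    N t i * N t j =
      if j = i then (1 - c t ^ 2) • (S t (i + 1) + S t (i + 2))
        + ((c t ^ 2 - 1) / 4) • R t i
      else (c t * (c t ^ 2 - 1) / 4) • S t (third i j) + ((1 - c t ^ 2) / 8) • (R t i + R t j)
        + (c t * (c t ^ 2 - 1) / 2) • R t (third i j) + ((1 - c t ^ 2) / 2) • N t (third i j) := by
  obtain rfl | rfl | rfl := fin_three_cases i j <;>
  simp only [S, D, R, N, smul_mul_assoc, mul_smul_comm, mul_add, add_mul, mul_sub, sub_mul,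
    e_mul_e, basisMul] <;>
  simp [mulAA, mulAV, mulAW, mulVV, mulVW, mulWW, add_assoc, third_self_add_one,
    third_self_add_two, third_add_one_self, third_add_two_self, third_add_one_add_two,
    third_add_two_add_one, c, S, D, R, N] <;>
  module

end M

/-! ### Eigenspaces, Frobenius forms and homomorphic images for general axes. -/

section General

variable {V : Type*} [NonUnitalNonAssocCommRing V] [Module ℝ V]
  [SMulCommClass ℝ V V] [IsScalarTower ℝ V V]

theorem mem_adEigenspace {a x : V} {μ : ℝ} : x ∈ adEigenspace a μ ↔ a * x = μ • x := by
  simp [adEigenspace]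

theorem iSupIndep_adEigenspace (F : FusionRule ℝ) (a : V) :
    iSupIndep fun i : F.Idx => adEigenspace a (F.val i) :=
  (Module.End.eigenspaces_iSupIndep (LinearMap.mulLeft ℝ a)).comp F.val_injective

/-- Subspaces of the eigenspaces that together span are the eigenspaces. -/
theorem adEigenspace_eq_of_iSup_eq_top {F : FusionRule ℝ} {a : V} {p : F.Idx → Submodule ℝ V}
    (hle : ∀ i, p i ≤ adEigenspace a (F.val i)) (htop : ⨆ i, p i = ⊤) (i : F.Idx) :
    adEigenspace a (F.val i) = p i := by
  refine le_antisymm ?_ (hle i)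
  have hdisj := iSupIndep_adEigenspace F a i
  have hsup : p i ⊔ ⨆ (j) (_ : j ≠ i), adEigenspace a (F.val j) = ⊤ := by
    rw [eq_top_iff, ← htop]
    refine iSup_le fun j => ?_
    by_cases h : j = i
    · subst h; exact le_sup_left
    · exact le_sup_of_le_right ((hle j).trans (le_iSup₂_of_le j h le_rfl))
  -- The modular law applies because `p i` lies in the eigenspace; independence of the eigenspaces
  -- kills the remaining intersection.
  calc adEigenspace a (F.val i)
      = (p i ⊔ ⨆ (j) (_ : j ≠ i), adEigenspace a (F.val j)) ⊓ adEigenspace a (F.val i) := by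
        rw [hsup, top_inf_eq]
    _ ≤ p i ⊔ (⨆ (j) (_ : j ≠ i), adEigenspace a (F.val j)) ⊓ adEigenspace a (F.val i) :=
        (sup_inf_assoc_of_le _ (hle i)).le
    _ = p i := by rw [hdisj.symm.eq_bot, sup_bot_eq]

theorem adEigenspaces_univ (F : FusionRule ℝ) (a : V) :
    adEigenspaces F a Set.univ = ⨆ i, adEigenspace a (F.val i) := by
  simp [adEigenspaces]

/-! ### Frobenius forms -/

/-- ⟨a, x⟩ = ⟨aa, x⟩ = ⟨a, ax⟩ = μ⟨a, x⟩. -/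
theorem IsFrobeniusForm.apply_eq_zero_of_eigenvector {A : Set V} {B : LinearMap.BilinForm ℝ V}
    (hB : IsFrobeniusForm A B) {a x : V} {μ : ℝ} (ha : a * a = a) (hx : a * x = μ • x)
    (hμ : μ ≠ 1) : B a x = 0 := by
  have h := hB.assoc a a x
  rw [ha, hx, map_smul, smul_eq_mul] at h
  have : (μ - 1) * B a x = 0 := by linarith
  exact (mul_eq_zero.1 this).resolve_left (sub_ne_zero.2 hμ)

/-- The Frobenius form of a primitive axial algebra is unique. -/
theorem IsPrimitiveAxialAlgebra.frobeniusForm_unique {A : Set V}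
    (hA : IsPrimitiveAxialAlgebra monster A) {B B' : LinearMap.BilinForm ℝ V}
    (hB : IsFrobeniusForm A B) (hB' : IsFrobeniusForm A B') : B = B' := by
  -- Against an axis both forms are the projection to ℝa: they vanish on the other eigenspaces, and
  -- primitivity with ⟨a, a⟩ = 1 settles the 1-eigenspace.
  have key : ∀ a ∈ A, B a = B' a := by
    intro a ha
    have htop := (hA.isAxis a ha).decomp
    rw [adEigenspaces_univ] at htop
    have hle : (⨆ i, adEigenspace a (monster.val i)) ≤ LinearMap.eqLocus (B a) (B' a) := by
      refine iSup_le fun i x hx => ?_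
      rw [LinearMap.mem_eqLocus]
      by_cases h1 : monster.val i = 1
      · rw [h1, (hA.isPrimitive a ha).2] at hx
        obtain ⟨r, rfl⟩ := Submodule.mem_span_singleton.1 hx
        rw [map_smul, map_smul, hB.norm_axis a ha, hB'.norm_axis a ha]
      · rw [mem_adEigenspace] at hx
        rw [hB.apply_eq_zero_of_eigenvector (hA.isAxis a ha).idem hx h1,
          hB'.apply_eq_zero_of_eigenvector (hA.isAxis a ha).idem hx h1]
    rw [htop] at hle
    ext x
    exact hle Submodule.mem_top
  ext x y
  have hx : x ∈ NonUnitalAlgebra.adjoin ℝ A := by rw [hA.generates]; trivial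
  have : B x = B' x := by
    induction hx using NonUnitalAlgebra.adjoin_induction with
    | mem a ha => exact key a ha
    | zero => simp
    | add u v _ _ hu hv => rw [map_add, map_add, hu, hv]
    | smul r u _ hu => rw [map_smul, map_smul, hu]
    -- ⟨uv, z⟩ = ⟨u, vz⟩ passes agreement from `u` to `uv`.
    | mul u v _ _ hu hv =>
      ext z
      rw [← hB.assoc, ← hB'.assoc, hu]
  rw [this]

/-! ### Homomorphic images -/

variable {W : Type*} [NonUnitalNonAssocCommRing W] [Module ℝ W]
  [SMulCommClass ℝ W W] [IsScalarTower ℝ W W]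

theorem map_adEigenspace_le (f : V →ₗ[ℝ] W) (hf : ∀ x y, f (x * y) = f x * f y) (a : V) (μ : ℝ) :
    (adEigenspace a μ).map f ≤ adEigenspace (f a) μ := by
  rintro _ ⟨x, hx, rfl⟩
  rw [SetLike.mem_coe, mem_adEigenspace] at hx
  rw [mem_adEigenspace, ← hf, hx, map_smul]

theorem map_adEigenspaces_le (F : FusionRule ℝ) (f : V →ₗ[ℝ] W)
    (hf : ∀ x y, f (x * y) = f x * f y) (a : V) (I : Set F.Idx) :
    (adEigenspaces F a I).map f ≤ adEigenspaces F (f a) I := by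
  simp only [adEigenspaces, Submodule.map_iSup]
  exact iSup₂_mono fun i _ => map_adEigenspace_le f hf a _

theorem IsAxis.iSup_map {F : FusionRule ℝ} {a : V} (ha : IsAxis F a) {f : V →ₗ[ℝ] W}
    (hs : Function.Surjective f) : ⨆ i, (adEigenspace a (F.val i)).map f = ⊤ := by
  rw [← Submodule.map_iSup, ← adEigenspaces_univ, ha.decomp, Submodule.map_top,
    LinearMap.range_eq_top.2 hs]

/-- The images of the eigenspaces already span the target, so no eigenspace of the image can be
larger. This is what carries primitivity over to quotients. -/
theorem IsAxis.adEigenspace_map {F : FusionRule ℝ} {a : V} (ha : IsAxis F a) {f : V →ₗ[ℝ] W}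
    (hf : ∀ x y, f (x * y) = f x * f y) (hs : Function.Surjective f) (i : F.Idx) :
    adEigenspace (f a) (F.val i) = (adEigenspace a (F.val i)).map f :=
  adEigenspace_eq_of_iSup_eq_top (fun i => map_adEigenspace_le f hf a (F.val i)) (ha.iSup_map hs) i

theorem IsAxis.map {F : FusionRule ℝ} {a : V} (ha : IsAxis F a) {f : V →ₗ[ℝ] W}
    (hf : ∀ x y, f (x * y) = f x * f y) (hs : Function.Surjective f) : IsAxis F (f a) where
  idem := by rw [← hf, ha.idem]
  decomp := by
    rw [adEigenspaces_univ]
    simp only [ha.adEigenspace_map hf hs]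
    exact ha.iSup_map hs
  fusion i j x hx y hy := by
    rw [ha.adEigenspace_map hf hs] at hx hy
    obtain ⟨x, hx, rfl⟩ := hx
    obtain ⟨y, hy, rfl⟩ := hy
    rw [← hf]
    exact map_adEigenspaces_le F f hf a _ (Submodule.mem_map_of_mem (ha.fusion i j x hx y hy))

theorem IsPrimitiveAxialAlgebra.map {A : Set V} (hA : IsPrimitiveAxialAlgebra monster A)
    {f : V →ₗ[ℝ] W} (hf : ∀ x y, f (x * y) = f x * f y) (hs : Function.Surjective f)
    (h0 : ∀ a ∈ A, f a ≠ 0) : IsPrimitiveAxialAlgebra monster (f '' A) where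
  isAxis := by
    rintro _ ⟨a, ha, rfl⟩
    exact (hA.isAxis a ha).map hf hs
  isPrimitive := by
    rintro _ ⟨a, ha, rfl⟩
    refine ⟨h0 a ha, ?_⟩
    have h := (hA.isAxis a ha).adEigenspace_map hf hs MonsterIdx.one
    change adEigenspace (f a) 1 = (adEigenspace a 1).map f at h
    rw [h, (hA.isPrimitive a ha).2, Submodule.map_span, Set.image_singleton]
  generates := by
    rw [eq_top_iff]
    intro y _
    obtain ⟨x, rfl⟩ := hs y
    have hx : x ∈ NonUnitalAlgebra.adjoin ℝ A := by rw [hA.generates]; trivial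
    induction hx using NonUnitalAlgebra.adjoin_induction with
    | mem a ha => exact NonUnitalAlgebra.subset_adjoin ℝ ⟨a, ha, rfl⟩
    | zero => rw [map_zero]; exact zero_mem _
    | add u v _ _ hu hv => rw [map_add]; exact add_mem (hu trivial) (hv trivial)
    | smul r u _ hu => rw [map_smul]; exact SMulMemClass.smul_mem r (hu trivial)
    | mul u v _ _ hu hv => rw [hf]; exact mul_mem (hu trivial) (hv trivial)

/-! ### Axes from eigenvector bases -/

theorem mul_mem_of_span {s u : Set V} {p : Submodule ℝ V} (h : ∀ x ∈ s, ∀ y ∈ u, x * y ∈ p)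
    {x y : V} (hx : x ∈ Submodule.span ℝ s) (hy : y ∈ Submodule.span ℝ u) : x * y ∈ p := by
  induction hx using Submodule.span_induction with
  | mem x hx =>
    induction hy using Submodule.span_induction with
    | mem y hy => exact h x hx y hy
    | zero => rw [mul_zero]; exact p.zero_mem
    | add y z _ _ hy hz => rw [mul_add]; exact p.add_mem hy hz
    | smul r y _ hy => rw [mul_smul_comm]; exact p.smul_mem r hy
  | zero => rw [zero_mul]; exact p.zero_mem
  | add y z _ _ hy hz => rw [add_mul]; exact p.add_mem hy hz
  | smul r y _ hy => rw [smul_mul_assoc]; exact p.smul_mem r hy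

/-- A criterion for being a primitive axis in terms of spanning sets of eigenvectors. -/
theorem isAxis_of_eigenvectors {a : V} {z q h : Set V} (idem : a * a = a)
    (hz : ∀ x ∈ z, a * x = 0) (hq : ∀ x ∈ q, a * x = (1 / 4 : ℝ) • x)
    (hh : ∀ x ∈ h, a * x = (1 / 32 : ℝ) • x)
    (top : Submodule.span ℝ ({a} ∪ z ∪ q ∪ h) = ⊤)
    (zz : ∀ x ∈ z, ∀ y ∈ z, x * y ∈ Submodule.span ℝ z)
    (zq : ∀ x ∈ z, ∀ y ∈ q, x * y ∈ Submodule.span ℝ q)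
    (zh : ∀ x ∈ z, ∀ y ∈ h, x * y ∈ Submodule.span ℝ h)
    (qq : ∀ x ∈ q, ∀ y ∈ q, x * y ∈ Submodule.span ℝ ({a} ∪ z))
    (qh : ∀ x ∈ q, ∀ y ∈ h, x * y ∈ Submodule.span ℝ h)
    (hh' : ∀ x ∈ h, ∀ y ∈ h, x * y ∈ Submodule.span ℝ ({a} ∪ z ∪ q)) :
    IsAxis monster a ∧ adEigenspace a 1 = Submodule.span ℝ {a} := by
  set p : MonsterIdx → Submodule ℝ V := fun i => match i with
    | .one => Submodule.span ℝ {a}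
    | .zero => Submodule.span ℝ z
    | .quarter => Submodule.span ℝ q
    | .thirtysecond => Submodule.span ℝ h with hp
  have hle : ∀ i : monster.Idx, p i ≤ adEigenspace a (monster.val i) := by
    rintro (_ | _ | _ | _) <;> refine Submodule.span_le.2 fun x hx => ?_ <;>
      rw [SetLike.mem_coe, mem_adEigenspace]
    · rw [Set.mem_singleton_iff.1 hx, idem]; exact (one_smul ℝ a).symm
    · rw [hz x hx]; exact (zero_smul ℝ x).symm
    · exact hq x hx
    · exact hh x hx
  have htop : ⨆ i : monster.Idx, p i = ⊤ := by
    rw [eq_top_iff, ← top, Submodule.span_union, Submodule.span_union, Submodule.span_union]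
    refine sup_le (sup_le (sup_le ?_ ?_) ?_) ?_
    · exact le_iSup p MonsterIdx.one
    · exact le_iSup p MonsterIdx.zero
    · exact le_iSup p MonsterIdx.quarter
    · exact le_iSup p MonsterIdx.thirtysecond
  have heq := adEigenspace_eq_of_iSup_eq_top hle htop
  refine ⟨⟨idem, ?_, ?_⟩, heq MonsterIdx.one⟩
  · rw [adEigenspaces_univ]; simp only [heq]; exact htop
  have sing : ∀ x ∈ ({a} : Set V), x = a := fun x hx => hx
  have za : ∀ x ∈ z, x * a = 0 := fun x hx => by rw [mul_comm, hz x hx]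
  have qa : ∀ x ∈ q, x * a = (1 / 4 : ℝ) • x := fun x hx => by rw [mul_comm, hq x hx]
  have ha : ∀ x ∈ h, x * a = (1 / 32 : ℝ) • x := fun x hx => by rw [mul_comm, hh x hx]
  have qz : ∀ x ∈ q, ∀ y ∈ z, x * y ∈ Submodule.span ℝ q := fun x hx y hy => by
    rw [mul_comm]; exact zq y hy x hx
  have hz' : ∀ x ∈ h, ∀ y ∈ z, x * y ∈ Submodule.span ℝ h := fun x hx y hy => by
    rw [mul_comm]; exact zh y hy x hx
  have hq' : ∀ x ∈ h, ∀ y ∈ q, x * y ∈ Submodule.span ℝ h := fun x hx y hy => by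
    rw [mul_comm]; exact qh y hy x hx
  have hop : ∀ I : Set monster.Idx, adEigenspaces monster a I = ⨆ i ∈ I, p i := by
    intro I; simp only [adEigenspaces, heq]
  intro i j x hx y hy
  rw [heq] at hx hy
  rw [hop]
  change x * y ∈ ⨆ k ∈ MonsterIdx.op i j, p k
  revert i j
  rintro (_ | _ | _ | _) (_ | _ | _ | _) hx hy <;>
    simp only [MonsterIdx.op, Set.mem_empty_iff_false, iSup_false, iSup_bot, iSup_singleton,
      iSup_insert, hp, ← Submodule.span_union, ← Set.union_assoc] at hx hy ⊢ <;>
    refine mul_mem_of_span ?_ hx hy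
  · rintro x rfl y rfl; rw [idem]; exact Submodule.mem_span_singleton_self _
  · rintro x rfl y hy; rw [hz y hy]; exact zero_mem _
  · rintro x rfl y hy; rw [hq y hy]; exact Submodule.smul_mem _ _ (Submodule.subset_span hy)
  · rintro x rfl y hy; rw [hh y hy]; exact Submodule.smul_mem _ _ (Submodule.subset_span hy)
  · rintro x hx y rfl; rw [za x hx]; exact zero_mem _
  · exact zz
  · exact zq
  · exact zh
  · rintro x hx y rfl; rw [qa x hx]; exact Submodule.smul_mem _ _ (Submodule.subset_span hx)
  · exact qz
  · exact qq
  · exact qh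
  · rintro x hx y rfl; rw [ha x hx]; exact Submodule.smul_mem _ _ (Submodule.subset_span hx)
  · exact hz'
  · exact hq'
  · exact hh'

end General

/-! ### The quotient by the radical -/

section Radical

variable {V : Type*} [NonUnitalNonAssocCommRing V] [Module ℝ V]
  [SMulCommClass ℝ V V] [IsScalarTower ℝ V V]
  {A : Set V} {B : LinearMap.BilinForm ℝ V}

/-- A symmetric Frobenius form induces a form on the quotient by its radical. -/
def IsFrobeniusForm.quotientForm (hB : IsFrobeniusForm A B) (hs : ∀ u v, B u v = B v u) :
    LinearMap.BilinForm ℝ hB.radical.Quotient :=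
  -- The form descends in one argument by definition of the kernel; symmetry is what lets it descend
  -- in the other.
  (LinearMap.ker B).liftQ (LinearMap.flip ((LinearMap.ker B).liftQ B le_rfl)) (by
    intro x hx
    rw [LinearMap.mem_ker] at hx ⊢
    ext y
    obtain ⟨y, rfl⟩ := hB.radical.proj_surjective y
    change B y x = 0
    rw [hs, hx]; rfl)

theorem IsFrobeniusForm.quotientForm_proj (hB : IsFrobeniusForm A B)
    (hs : ∀ u v, B u v = B v u) (x y : V) :
    hB.quotientForm hs (hB.radical.proj x) (hB.radical.proj y) = B x y := by
  rw [hs]; rfl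

/-- The degenerate Cauchy–Schwarz argument: ⟨rx + y, rx + y⟩ is affine in `r`, and an affine
function bounded below is constant. -/
theorem eq_zero_of_apply_self_eq_zero (hs : ∀ u v, B u v = B v u) (hpos : ∀ u, 0 ≤ B u u)
    {x : V} (hx : B x x = 0) : B x = 0 := by
  ext y
  have h : ∀ r : ℝ, 0 ≤ 2 * r * B x y + B y y := fun r => by
    have := hpos (r • x + y)
    simp only [map_add, map_smul, LinearMap.add_apply, LinearMap.smul_apply, smul_eq_mul, hx,
      hs y x] at this
    linarith
  by_contra h0
  rw [LinearMap.zero_apply] at h0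
  -- This `r` makes the affine function equal to -1.
  have h1 := h (-(B y y + 1) / (2 * B x y))
  have h2 : 2 * (-(B y y + 1) / (2 * B x y)) * B x y = -(B y y + 1) := by field_simp
  linarith

/-- If the Frobenius form is positive semidefinite and satisfies Norton's inequality then the
quotient by its radical is a Majorana algebra. -/
theorem IsFrobeniusForm.isMajoranaAlgebra_quotient (hB : IsFrobeniusForm A B)
    (hA : IsPrimitiveAxialAlgebra monster A) (hs : ∀ u v, B u v = B v u)
    (hpos : ∀ u, 0 ≤ B u u) (hN : NortonInequality B) :
    IsMajoranaAlgebra (hB.radical.proj '' A) := by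
  have hq := hB.quotientForm_proj hs
  have hsurj := hB.radical.proj_surjective
  have hmul := hB.radical.proj_mul
  refine ⟨hA.map hmul hsurj ?_, hB.quotientForm hs, ⟨?_, ?_, ?_⟩, ⟨?_, ?_⟩, ?_⟩
  · intro a ha h0
    have := hq a a
    rw [h0, map_zero, hB.norm_axis a ha] at this
    exact zero_ne_one this
  · intro h0
    apply hB.ne_zero
    ext x y
    rw [← hq, h0]; rfl
  · intro u v w
    obtain ⟨u, rfl⟩ := hsurj u
    obtain ⟨v, rfl⟩ := hsurj v
    obtain ⟨w, rfl⟩ := hsurj w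
    rw [← hmul, ← hmul, hq, hq, hB.assoc]
  · rintro _ ⟨a, ha, rfl⟩
    rw [hq, hB.norm_axis a ha]
  · intro u v
    obtain ⟨u, rfl⟩ := hsurj u
    obtain ⟨v, rfl⟩ := hsurj v
    rw [hq, hq, hs]
  · intro v hv
    obtain ⟨v, rfl⟩ := hsurj v
    rw [hq]
    refine lt_of_le_of_ne (hpos v) fun h => hv ?_
    have : v ∈ LinearMap.ker B := eq_zero_of_apply_self_eq_zero hs hpos h.symm
    rw [← map_zero hB.radical.proj, hB.radical.proj_eq_proj, sub_zero]
    exact this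
  · intro u v
    obtain ⟨u, rfl⟩ := hsurj u
    obtain ⟨v, rfl⟩ := hsurj v
    rw [← hmul, ← hmul, ← hmul, hq, hq]
    exact hN u v

end Radical

/-! ### Peirce decomposition of the even part with respect to `S i`. -/

namespace M

variable (t : ℝ)

/-- Basis of the `0`-eigenspace of `S i` in the span of `S, R, N`. -/
def Z (i : Fin 3) : Fin 4 → M t :=
  ![S t (i + 1) - (1 / 4 : ℝ) • R t (i + 2) + (1 / 16 : ℝ) • S t i,
    S t (i + 2) - (1 / 4 : ℝ) • R t (i + 1) + (1 / 16 : ℝ) • S t i,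
    R t i - (c t / 4) • (R t (i + 1) + R t (i + 2)) + (1 / 4 : ℝ) • (N t (i + 1) + N t (i + 2))
      + (c t / 8) • S t i,
    N t i - ((c t ^ 2 - 1) / 4) • (R t (i + 1) + R t (i + 2))
      + (c t / 4) • (N t (i + 1) + N t (i + 2)) + ((c t ^ 2 - 1) / 8) • S t i]

/-- Basis of the `1 / 2`-eigenspace of `S i` in the span of `S, R, N`. -/
def Q (i : Fin 3) : Fin 4 → M t :=
  ![R t (i + 2) - (1 / 2 : ℝ) • S t i, R t (i + 1) - (1 / 2 : ℝ) • S t i, N t (i + 2), N t (i + 1)]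

theorem R_mul_S (i j : Fin 3) : R t i * S t j = S t j * R t i := mul_comm _ _
theorem N_mul_S (i j : Fin 3) : N t i * S t j = S t j * N t i := mul_comm _ _
theorem N_mul_R (i j : Fin 3) : N t i * R t j = R t j * N t i := mul_comm _ _
theorem D_mul_S (i j : Fin 3) : D t i * S t j = S t j * D t i := mul_comm _ _

theorem mem_span_range {V : Type*} [AddCommGroup V] [Module ℝ V] {v : Fin 4 → V} {x : V}
    (c₀ c₁ c₂ c₃ : ℝ) (h : x = c₀ • v 0 + c₁ • v 1 + c₂ • v 2 + c₃ • v 3) :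
    x ∈ Submodule.span ℝ (Set.range v) := by
  have hv := fun i => Submodule.smul_mem (Submodule.span ℝ (Set.range v)) (![c₀, c₁, c₂, c₃] i)
    (Submodule.subset_span (Set.mem_range_self i))
  rw [h]
  exact add_mem (add_mem (add_mem (hv 0) (hv 1)) (hv 2)) (hv 3)

theorem mem_span_insert_range {V : Type*} [AddCommGroup V] [Module ℝ V] {v : Fin 4 → V} {s x : V}
    (c c₀ c₁ c₂ c₃ : ℝ) (h : x = c • s + (c₀ • v 0 + c₁ • v 1 + c₂ • v 2 + c₃ • v 3)) :
    x ∈ Submodule.span ℝ (insert s (Set.range v)) :=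
  Submodule.mem_span_insert.2 ⟨c, _, mem_span_range c₀ c₁ c₂ c₃ rfl, h⟩

/-- The Peirce rule 0 * 0 = 0, checked on a basis; commutativity reduces it to m ≤ n. Each of the
four `Z` contains exactly one of S_{i+1}, S_{i+2}, R_i, N_i, with coefficient 1, so the listed
coordinates are the coefficients of those four vectors in the expanded product. -/
theorem Z_mul_Z_of_le (i : Fin 3) : ∀ m n : Fin 4, m ≤ n →
    Z t i m * Z t i n ∈ Submodule.span ℝ (Set.range (Z t i))
  | 0, 0, _ => mem_span_range (15 / 16) 0 0 0 (by
      simp [Z, Q, mul_add, add_mul, mul_sub, sub_mul, smul_mul_assoc, mul_smul_comm, R_mul_S,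
        N_mul_S, N_mul_R, S_mul_S, S_mul_R, S_mul_N, R_mul_R, R_mul_N, N_mul_N, add_assoc,
        third_self_add_one, third_self_add_two, third_add_one_self, third_add_two_self,
        third_add_one_add_two, third_add_two_add_one]
      module)
  | 0, 1, _ => mem_span_range 0 0 (1 / 8 - c t / 32) (1 / 32) (by
      simp [Z, Q, mul_add, add_mul, mul_sub, sub_mul, smul_mul_assoc, mul_smul_comm, R_mul_S,
        N_mul_S, N_mul_R, S_mul_S, S_mul_R, S_mul_N, R_mul_R, R_mul_N, N_mul_N, add_assoc,
        third_self_add_one, third_self_add_two, third_add_one_self, third_add_two_self,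
        third_add_one_add_two, third_add_two_add_one]
      module)
  | 0, 2, _ => mem_span_range (1 / 4 - c t / 16) 0 (15 / 32) 0 (by
      simp [Z, Q, mul_add, add_mul, mul_sub, sub_mul, smul_mul_assoc, mul_smul_comm, R_mul_S,
        N_mul_S, N_mul_R, S_mul_S, S_mul_R, S_mul_N, R_mul_R, R_mul_N, N_mul_N, add_assoc,
        third_self_add_one, third_self_add_two, third_add_one_self, third_add_two_self,
        third_add_one_add_two, third_add_two_add_one]
      module)
  | 0, 3, _ => mem_span_range (1 / 16 - c t ^ 2 / 16) 0 0 (15 / 32) (by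
      simp [Z, Q, mul_add, add_mul, mul_sub, sub_mul, smul_mul_assoc, mul_smul_comm, R_mul_S,
        N_mul_S, N_mul_R, S_mul_S, S_mul_R, S_mul_N, R_mul_R, R_mul_N, N_mul_N, add_assoc,
        third_self_add_one, third_self_add_two, third_add_one_self, third_add_two_self,
        third_add_one_add_two, third_add_two_add_one]
      module)
  | 1, 0, h => absurd h (by decide)
  | 1, 1, _ => mem_span_range 0 (15 / 16) 0 0 (by
      simp [Z, Q, mul_add, add_mul, mul_sub, sub_mul, smul_mul_assoc, mul_smul_comm, R_mul_S,
        N_mul_S, N_mul_R, S_mul_S, S_mul_R, S_mul_N, R_mul_R, R_mul_N, N_mul_N, add_assoc,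
        third_self_add_one, third_self_add_two, third_add_one_self, third_add_two_self,
        third_add_one_add_two, third_add_two_add_one]
      module)
  | 1, 2, _ => mem_span_range 0 (1 / 4 - c t / 16) (15 / 32) 0 (by
      simp [Z, Q, mul_add, add_mul, mul_sub, sub_mul, smul_mul_assoc, mul_smul_comm, R_mul_S,
        N_mul_S, N_mul_R, S_mul_S, S_mul_R, S_mul_N, R_mul_R, R_mul_N, N_mul_N, add_assoc,
        third_self_add_one, third_self_add_two, third_add_one_self, third_add_two_self,
        third_add_one_add_two, third_add_two_add_one]
      module)
  | 1, 3, _ => mem_span_range 0 (1 / 16 - c t ^ 2 / 16) 0 (15 / 32) (by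
      simp [Z, Q, mul_add, add_mul, mul_sub, sub_mul, smul_mul_assoc, mul_smul_comm, R_mul_S,
        N_mul_S, N_mul_R, S_mul_S, S_mul_R, S_mul_N, R_mul_R, R_mul_N, N_mul_N, add_assoc,
        third_self_add_one, third_self_add_two, third_add_one_self, third_add_two_self,
        third_add_one_add_two, third_add_two_add_one]
      module)
  | 2, 0, h => absurd h (by decide)
  | 2, 1, h => absurd h (by decide)
  | 2, 2, _ => mem_span_range (15 / 16) (15 / 16) (1 / 4 - c t / 16) (-1 / 16) (by
      simp [Z, Q, mul_add, add_mul, mul_sub, sub_mul, smul_mul_assoc, mul_smul_comm, R_mul_S,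
        N_mul_S, N_mul_R, S_mul_S, S_mul_R, S_mul_N, R_mul_R, R_mul_N, N_mul_N, add_assoc,
        third_self_add_one, third_self_add_two, third_add_one_self, third_add_two_self,
        third_add_one_add_two, third_add_two_add_one]
      module)
  | 2, 3, _ => mem_span_range 0 0 (1 / 16 - c t ^ 2 / 16) (1 / 4 - c t / 16) (by
      simp [Z, Q, mul_add, add_mul, mul_sub, sub_mul, smul_mul_assoc, mul_smul_comm, R_mul_S,
        N_mul_S, N_mul_R, S_mul_S, S_mul_R, S_mul_N, R_mul_R, R_mul_N, N_mul_N, add_assoc,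
        third_self_add_one, third_self_add_two, third_add_one_self, third_add_two_self,
        third_add_one_add_two, third_add_two_add_one]
      module)
  | 3, 0, h => absurd h (by decide)
  | 3, 1, h => absurd h (by decide)
  | 3, 2, h => absurd h (by decide)
  | 3, 3, _ => mem_span_range (15 / 16 - 15 * c t ^ 2 / 16) (15 / 16 - 15 * c t ^ 2 / 16) (-1 / 4 + c t / 16 + c t ^ 2 / 4 - c t ^ 3 / 16) (1 / 16 - c t ^ 2 / 16) (by
      simp [Z, Q, mul_add, add_mul, mul_sub, sub_mul, smul_mul_assoc, mul_smul_comm, R_mul_S,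
        N_mul_S, N_mul_R, S_mul_S, S_mul_R, S_mul_N, R_mul_R, R_mul_N, N_mul_N, add_assoc,
        third_self_add_one, third_self_add_two, third_add_one_self, third_add_two_self,
        third_add_one_add_two, third_add_two_add_one]
      module)

/-- The Peirce rule 0 * 1/2 = 1/2. Coordinates in `Q` are the coefficients of R_{i+2}, R_{i+1},
N_{i+2}, N_{i+1}. -/
theorem Z_mul_Q (i : Fin 3) : ∀ m n : Fin 4,
    Z t i m * Q t i n ∈ Submodule.span ℝ (Set.range (Q t i))
  | 0, 0 => mem_span_range (15 / 32) 0 0 0 (by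
      simp [Z, Q, mul_add, add_mul, mul_sub, sub_mul, smul_mul_assoc, mul_smul_comm, R_mul_S,
        N_mul_S, N_mul_R, S_mul_S, S_mul_R, S_mul_N, R_mul_R, R_mul_N, N_mul_N, add_assoc,
        third_self_add_one, third_self_add_two, third_add_one_self, third_add_two_self,
        third_add_one_add_two, third_add_two_add_one]
      module)
  | 0, 1 => mem_span_range (-1 / 32 + c t / 8) 0 (-1 / 8) 0 (by
      simp [Z, Q, mul_add, add_mul, mul_sub, sub_mul, smul_mul_assoc, mul_smul_comm, R_mul_S,
        N_mul_S, N_mul_R, S_mul_S, S_mul_R, S_mul_N, R_mul_R, R_mul_N, N_mul_N, add_assoc,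
        third_self_add_one, third_self_add_two, third_add_one_self, third_add_two_self,
        third_add_one_add_two, third_add_two_add_one]
      module)
  | 0, 2 => mem_span_range 0 0 (15 / 32) 0 (by
      simp [Z, Q, mul_add, add_mul, mul_sub, sub_mul, smul_mul_assoc, mul_smul_comm, R_mul_S,
        N_mul_S, N_mul_R, S_mul_S, S_mul_R, S_mul_N, R_mul_R, R_mul_N, N_mul_N, add_assoc,
        third_self_add_one, third_self_add_two, third_add_one_self, third_add_two_self,
        third_add_one_add_two, third_add_two_add_one]
      module)
  | 0, 3 => mem_span_range (-1 / 8 + c t ^ 2 / 8) 0 (1 / 32 - c t / 8) 0 (by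
      simp [Z, Q, mul_add, add_mul, mul_sub, sub_mul, smul_mul_assoc, mul_smul_comm, R_mul_S,
        N_mul_S, N_mul_R, S_mul_S, S_mul_R, S_mul_N, R_mul_R, R_mul_N, N_mul_N, add_assoc,
        third_self_add_one, third_self_add_two, third_add_one_self, third_add_two_self,
        third_add_one_add_two, third_add_two_add_one]
      module)
  | 1, 0 => mem_span_range 0 (-1 / 32 + c t / 8) 0 (-1 / 8) (by
      simp [Z, Q, mul_add, add_mul, mul_sub, sub_mul, smul_mul_assoc, mul_smul_comm, R_mul_S,
        N_mul_S, N_mul_R, S_mul_S, S_mul_R, S_mul_N, R_mul_R, R_mul_N, N_mul_N, add_assoc,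
        third_self_add_one, third_self_add_two, third_add_one_self, third_add_two_self,
        third_add_one_add_two, third_add_two_add_one]
      module)
  | 1, 1 => mem_span_range 0 (15 / 32) 0 0 (by
      simp [Z, Q, mul_add, add_mul, mul_sub, sub_mul, smul_mul_assoc, mul_smul_comm, R_mul_S,
        N_mul_S, N_mul_R, S_mul_S, S_mul_R, S_mul_N, R_mul_R, R_mul_N, N_mul_N, add_assoc,
        third_self_add_one, third_self_add_two, third_add_one_self, third_add_two_self,
        third_add_one_add_two, third_add_two_add_one]
      module)
  | 1, 2 => mem_span_range 0 (-1 / 8 + c t ^ 2 / 8) 0 (1 / 32 - c t / 8) (by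
      simp [Z, Q, mul_add, add_mul, mul_sub, sub_mul, smul_mul_assoc, mul_smul_comm, R_mul_S,
        N_mul_S, N_mul_R, S_mul_S, S_mul_R, S_mul_N, R_mul_R, R_mul_N, N_mul_N, add_assoc,
        third_self_add_one, third_self_add_two, third_add_one_self, third_add_two_self,
        third_add_one_add_two, third_add_two_add_one]
      module)
  | 1, 3 => mem_span_range 0 0 0 (15 / 32) (by
      simp [Z, Q, mul_add, add_mul, mul_sub, sub_mul, smul_mul_assoc, mul_smul_comm, R_mul_S,
        N_mul_S, N_mul_R, S_mul_S, S_mul_R, S_mul_N, R_mul_R, R_mul_N, N_mul_N, add_assoc,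
        third_self_add_one, third_self_add_two, third_add_one_self, third_add_two_self,
        third_add_one_add_two, third_add_two_add_one]
      module)
  | 2, 0 => mem_span_range (1 / 8 - c t / 32) (15 * c t / 32) (1 / 32) (-15 / 32) (by
      simp [Z, Q, mul_add, add_mul, mul_sub, sub_mul, smul_mul_assoc, mul_smul_comm, R_mul_S,
        N_mul_S, N_mul_R, S_mul_S, S_mul_R, S_mul_N, R_mul_R, R_mul_N, N_mul_N, add_assoc,
        third_self_add_one, third_self_add_two, third_add_one_self, third_add_two_self,
        third_add_one_add_two, third_add_two_add_one]
      module)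
  | 2, 1 => mem_span_range (15 * c t / 32) (1 / 8 - c t / 32) (-15 / 32) (1 / 32) (by
      simp [Z, Q, mul_add, add_mul, mul_sub, sub_mul, smul_mul_assoc, mul_smul_comm, R_mul_S,
        N_mul_S, N_mul_R, S_mul_S, S_mul_R, S_mul_N, R_mul_R, R_mul_N, N_mul_N, add_assoc,
        third_self_add_one, third_self_add_two, third_add_one_self, third_add_two_self,
        third_add_one_add_two, third_add_two_add_one]
      module)
  | 2, 2 => mem_span_range (-1 / 32 + c t ^ 2 / 32) (-15 / 32 + 15 * c t ^ 2 / 32) (1 / 8 - c t / 32) (-15 * c t / 32) (by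
      simp [Z, Q, mul_add, add_mul, mul_sub, sub_mul, smul_mul_assoc, mul_smul_comm, R_mul_S,
        N_mul_S, N_mul_R, S_mul_S, S_mul_R, S_mul_N, R_mul_R, R_mul_N, N_mul_N, add_assoc,
        third_self_add_one, third_self_add_two, third_add_one_self, third_add_two_self,
        third_add_one_add_two, third_add_two_add_one]
      module)
  | 2, 3 => mem_span_range (-15 / 32 + 15 * c t ^ 2 / 32) (-1 / 32 + c t ^ 2 / 32) (-15 * c t / 32) (1 / 8 - c t / 32) (by
      simp [Z, Q, mul_add, add_mul, mul_sub, sub_mul, smul_mul_assoc, mul_smul_comm, R_mul_S,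
        N_mul_S, N_mul_R, S_mul_S, S_mul_R, S_mul_N, R_mul_R, R_mul_N, N_mul_N, add_assoc,
        third_self_add_one, third_self_add_two, third_add_one_self, third_add_two_self,
        third_add_one_add_two, third_add_two_add_one]
      module)
  | 3, 0 => mem_span_range (1 / 32 - c t ^ 2 / 32) (-15 / 32 + 15 * c t ^ 2 / 32) (-1 / 8 + c t / 32) (-15 * c t / 32) (by
      simp [Z, Q, mul_add, add_mul, mul_sub, sub_mul, smul_mul_assoc, mul_smul_comm, R_mul_S,
        N_mul_S, N_mul_R, S_mul_S, S_mul_R, S_mul_N, R_mul_R, R_mul_N, N_mul_N, add_assoc,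
        third_self_add_one, third_self_add_two, third_add_one_self, third_add_two_self,
        third_add_one_add_two, third_add_two_add_one]
      module)
  | 3, 1 => mem_span_range (-15 / 32 + 15 * c t ^ 2 / 32) (1 / 32 - c t ^ 2 / 32) (-15 * c t / 32) (-1 / 8 + c t / 32) (by
      simp [Z, Q, mul_add, add_mul, mul_sub, sub_mul, smul_mul_assoc, mul_smul_comm, R_mul_S,
        N_mul_S, N_mul_R, S_mul_S, S_mul_R, S_mul_N, R_mul_R, R_mul_N, N_mul_N, add_assoc,
        third_self_add_one, third_self_add_two, third_add_one_self, third_add_two_self,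
        third_add_one_add_two, third_add_two_add_one]
      module)
  | 3, 2 => mem_span_range (1 / 8 - c t / 32 - c t ^ 2 / 8 + c t ^ 3 / 32) (-15 * c t / 32 + 15 * c t ^ 3 / 32) (1 / 32 - c t ^ 2 / 32) (15 / 32 - 15 * c t ^ 2 / 32) (by
      simp [Z, Q, mul_add, add_mul, mul_sub, sub_mul, smul_mul_assoc, mul_smul_comm, R_mul_S,
        N_mul_S, N_mul_R, S_mul_S, S_mul_R, S_mul_N, R_mul_R, R_mul_N, N_mul_N, add_assoc,
        third_self_add_one, third_self_add_two, third_add_one_self, third_add_two_self,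
        third_add_one_add_two, third_add_two_add_one]
      module)
  | 3, 3 => mem_span_range (-15 * c t / 32 + 15 * c t ^ 3 / 32) (1 / 8 - c t / 32 - c t ^ 2 / 8 + c t ^ 3 / 32) (15 / 32 - 15 * c t ^ 2 / 32) (1 / 32 - c t ^ 2 / 32) (by
      simp [Z, Q, mul_add, add_mul, mul_sub, sub_mul, smul_mul_assoc, mul_smul_comm, R_mul_S,
        N_mul_S, N_mul_R, S_mul_S, S_mul_R, S_mul_N, R_mul_R, R_mul_N, N_mul_N, add_assoc,
        third_self_add_one, third_self_add_two, third_add_one_self, third_add_two_self,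
        third_add_one_add_two, third_add_two_add_one]
      module)

/-- The Peirce rule 1/2 * 1/2 = {1, 0}. The `Z` coordinates are read off as in `Z_mul_Z_of_le`, and
the first number is what then remains of S_i. -/
theorem Q_mul_Q_of_le (i : Fin 3) : ∀ m n : Fin 4, m ≤ n →
    Q t i m * Q t i n ∈ Submodule.span ℝ (insert (S t i) (Set.range (Z t i)))
  | 0, 0, _ => mem_span_insert_range (15 / 16) 1 0 0 0 (by
      simp [Z, Q, mul_add, add_mul, mul_sub, sub_mul, smul_mul_assoc, mul_smul_comm, R_mul_S,
        N_mul_S, N_mul_R, S_mul_S, S_mul_R, S_mul_N, R_mul_R, R_mul_N, N_mul_N, add_assoc,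
        third_self_add_one, third_self_add_two, third_add_one_self, third_add_two_self,
        third_add_one_add_two, third_add_two_add_one]
      module)
  | 0, 1, _ => mem_span_insert_range (-1 / 16 + c t / 4) 0 0 (c t / 2) (-1 / 2) (by
      simp [Z, Q, mul_add, add_mul, mul_sub, sub_mul, smul_mul_assoc, mul_smul_comm, R_mul_S,
        N_mul_S, N_mul_R, S_mul_S, S_mul_R, S_mul_N, R_mul_R, R_mul_N, N_mul_N, add_assoc,
        third_self_add_one, third_self_add_two, third_add_one_self, third_add_two_self,
        third_add_one_add_two, third_add_two_add_one]
      module)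
  | 0, 2, _ => mem_span_insert_range 0 0 0 0 0 (by
      simp [Z, Q, mul_add, add_mul, mul_sub, sub_mul, smul_mul_assoc, mul_smul_comm, R_mul_S,
        N_mul_S, N_mul_R, S_mul_S, S_mul_R, S_mul_N, R_mul_R, R_mul_N, N_mul_N, add_assoc,
        third_self_add_one, third_self_add_two, third_add_one_self, third_add_two_self,
        third_add_one_add_two, third_add_two_add_one]
      module)
  | 0, 3, _ => mem_span_insert_range (-1 / 4 + c t ^ 2 / 4) 0 0 (-1 / 2 + c t ^ 2 / 2) (-c t / 2) (by
      simp [Z, Q, mul_add, add_mul, mul_sub, sub_mul, smul_mul_assoc, mul_smul_comm, R_mul_S,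
        N_mul_S, N_mul_R, S_mul_S, S_mul_R, S_mul_N, R_mul_R, R_mul_N, N_mul_N, add_assoc,
        third_self_add_one, third_self_add_two, third_add_one_self, third_add_two_self,
        third_add_one_add_two, third_add_two_add_one]
      module)
  | 1, 0, h => absurd h (by decide)
  | 1, 1, _ => mem_span_insert_range (15 / 16) 0 1 0 0 (by
      simp [Z, Q, mul_add, add_mul, mul_sub, sub_mul, smul_mul_assoc, mul_smul_comm, R_mul_S,
        N_mul_S, N_mul_R, S_mul_S, S_mul_R, S_mul_N, R_mul_R, R_mul_N, N_mul_N, add_assoc,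
        third_self_add_one, third_self_add_two, third_add_one_self, third_add_two_self,
        third_add_one_add_two, third_add_two_add_one]
      module)
  | 1, 2, _ => mem_span_insert_range (-1 / 4 + c t ^ 2 / 4) 0 0 (-1 / 2 + c t ^ 2 / 2) (-c t / 2) (by
      simp [Z, Q, mul_add, add_mul, mul_sub, sub_mul, smul_mul_assoc, mul_smul_comm, R_mul_S,
        N_mul_S, N_mul_R, S_mul_S, S_mul_R, S_mul_N, R_mul_R, R_mul_N, N_mul_N, add_assoc,
        third_self_add_one, third_self_add_two, third_add_one_self, third_add_two_self,
        third_add_one_add_two, third_add_two_add_one]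
      module)
  | 1, 3, _ => mem_span_insert_range 0 0 0 0 0 (by
      simp [Z, Q, mul_add, add_mul, mul_sub, sub_mul, smul_mul_assoc, mul_smul_comm, R_mul_S,
        N_mul_S, N_mul_R, S_mul_S, S_mul_R, S_mul_N, R_mul_R, R_mul_N, N_mul_N, add_assoc,
        third_self_add_one, third_self_add_two, third_add_one_self, third_add_two_self,
        third_add_one_add_two, third_add_two_add_one]
      module)
  | 2, 0, h => absurd h (by decide)
  | 2, 1, h => absurd h (by decide)
  | 2, 2, _ => mem_span_insert_range (15 / 16 - 15 * c t ^ 2 / 16) (1 - c t ^ 2) 0 0 0 (by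
      simp [Z, Q, mul_add, add_mul, mul_sub, sub_mul, smul_mul_assoc, mul_smul_comm, R_mul_S,
        N_mul_S, N_mul_R, S_mul_S, S_mul_R, S_mul_N, R_mul_R, R_mul_N, N_mul_N, add_assoc,
        third_self_add_one, third_self_add_two, third_add_one_self, third_add_two_self,
        third_add_one_add_two, third_add_two_add_one]
      module)
  | 2, 3, _ => mem_span_insert_range (1 / 16 - c t / 4 - c t ^ 2 / 16 + c t ^ 3 / 4) 0 0 (-c t / 2 + c t ^ 3 / 2) (1 / 2 - c t ^ 2 / 2) (by
      simp [Z, Q, mul_add, add_mul, mul_sub, sub_mul, smul_mul_assoc, mul_smul_comm, R_mul_S,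
        N_mul_S, N_mul_R, S_mul_S, S_mul_R, S_mul_N, R_mul_R, R_mul_N, N_mul_N, add_assoc,
        third_self_add_one, third_self_add_two, third_add_one_self, third_add_two_self,
        third_add_one_add_two, third_add_two_add_one]
      module)
  | 3, 0, h => absurd h (by decide)
  | 3, 1, h => absurd h (by decide)
  | 3, 2, h => absurd h (by decide)
  | 3, 3, _ => mem_span_insert_range (15 / 16 - 15 * c t ^ 2 / 16) 0 (1 - c t ^ 2) 0 0 (by
      simp [Z, Q, mul_add, add_mul, mul_sub, sub_mul, smul_mul_assoc, mul_smul_comm, R_mul_S,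
        N_mul_S, N_mul_R, S_mul_S, S_mul_R, S_mul_N, R_mul_R, R_mul_N, N_mul_N, add_assoc,
        third_self_add_one, third_self_add_two, third_add_one_self, third_add_two_self,
        third_add_one_add_two, third_add_two_add_one]
      module)

end M

/-! ### The six axes, their fusion rules, and generation. -/

namespace M

variable (t : ℝ)

theorem eq_sum_smul_e (x : M t) : x = ∑ p, x p • e t p := by
  have h : ∀ (s : Finset Label) (q : Label), (∑ p ∈ s, x p • e t p) q
      = ∑ p ∈ s, (x p • e t p) q := by
    intro s q
    induction s using Finset.induction_on with
    | empty => rfl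
    | insert b s hb ih => rw [Finset.sum_insert hb, Finset.sum_insert hb, add_apply, ih]
  funext q
  rw [h, Finset.sum_eq_single q]
  · simp [smul_apply, e_apply]
  · intro b _ hb
    simp [smul_apply, e_apply, hb.symm]
  · simp

theorem a_true (i : Fin 3) : a t i true = (1 / 2 : ℝ) • (S t i + D t i) := by
  simp only [S, D]; module
theorem a_false (i : Fin 3) : a t i false = (1 / 2 : ℝ) • (S t i - D t i) := by
  simp only [S, D]; module
theorem v_eq (i : Fin 3) : v t i = (2 / 3 : ℝ) • (S t (i + 1) + S t (i + 2) - R t i) := by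
  simp only [R]; module
theorem w_eq (i : Fin 3) : w t i = (1 / 24 : ℝ) • (N t (i + 1) + N t (i + 2))
    - (3 * t / 4) • (v t (i + 1) + v t (i + 2))
    + (t / 2) • ((2 : ℝ) • S t i + S t (i + 1) + S t (i + 2) + D t i) := by
  simp [N, add_assoc]; module

variable {t}

/-- The inverse change of basis above shows that `S`, `D`, `R`, `N` span; later linear statements
are tested on these vectors only. -/
theorem eq_top_of_mem {p : Submodule ℝ (M t)} (hS : ∀ i, S t i ∈ p) (hD : ∀ i, D t i ∈ p)
    (hR : ∀ i, R t i ∈ p) (hN : ∀ i, N t i ∈ p) : p = ⊤ := by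
  have hv : ∀ i, v t i ∈ p := fun i => by
    rw [v_eq]
    exact p.smul_mem _ (p.sub_mem (p.add_mem (hS _) (hS _)) (hR _))
  rw [eq_top_iff]
  intro x _
  rw [eq_sum_smul_e t x]
  refine p.sum_mem fun q _ => p.smul_mem _ ?_
  rcases q with ⟨i, s⟩ | i | i
  · cases s
    · change a t i false ∈ p
      rw [a_false]; exact p.smul_mem _ (p.sub_mem (hS _) (hD _))
    · change a t i true ∈ p
      rw [a_true]; exact p.smul_mem _ (p.add_mem (hS _) (hD _))
  · exact hv i
  · change w t i ∈ p
    rw [w_eq]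
    exact p.add_mem (p.sub_mem (p.smul_mem _ (p.add_mem (hN _) (hN _)))
      (p.smul_mem _ (p.add_mem (hv _) (hv _)))) (p.smul_mem _ (p.add_mem (p.add_mem
      (p.add_mem (p.smul_mem _ (hS _)) (hS _)) (hS _)) (hD _)))

variable (t)

/-- The subalgebra fixed by the sign changes `D i ↦ - D i`. -/
def evenPart : Submodule ℝ (M t) :=
  Submodule.span ℝ (Set.range (S t) ∪ Set.range (R t) ∪ Set.range (N t))

theorem S_mem_evenPart (i : Fin 3) : S t i ∈ evenPart t :=
  Submodule.subset_span (.inl (.inl ⟨i, rfl⟩))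
theorem R_mem_evenPart (i : Fin 3) : R t i ∈ evenPart t :=
  Submodule.subset_span (.inl (.inr ⟨i, rfl⟩))
theorem N_mem_evenPart (i : Fin 3) : N t i ∈ evenPart t :=
  Submodule.subset_span (.inr ⟨i, rfl⟩)

theorem Z_mem_evenPart (i : Fin 3) (m : Fin 4) : Z t i m ∈ evenPart t := by
  have hS := S_mem_evenPart t
  have hR := R_mem_evenPart t
  have hN := N_mem_evenPart t
  have hs := fun (r : ℝ) (x : M t) => (evenPart t).smul_mem (x := x) r
  fin_cases m
  · exact add_mem (sub_mem (hS _) (hs _ _ (hR _))) (hs _ _ (hS _))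
  · exact add_mem (sub_mem (hS _) (hs _ _ (hR _))) (hs _ _ (hS _))
  · exact add_mem (add_mem (sub_mem (hR _) (hs _ _ (add_mem (hR _) (hR _))))
      (hs _ _ (add_mem (hN _) (hN _)))) (hs _ _ (hS _))
  · exact add_mem (add_mem (sub_mem (hN _) (hs _ _ (add_mem (hR _) (hR _))))
      (hs _ _ (add_mem (hN _) (hN _)))) (hs _ _ (hS _))

theorem Q_mem_evenPart (i : Fin 3) (m : Fin 4) : Q t i m ∈ evenPart t := by
  have hS := S_mem_evenPart t
  have hR := R_mem_evenPart t
  have hN := N_mem_evenPart t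
  fin_cases m
  · exact sub_mem (hR _) ((evenPart t).smul_mem _ (hS _))
  · exact sub_mem (hR _) ((evenPart t).smul_mem _ (hS _))
  · exact hN _
  · exact hN _

/-- Even elements act on each `D i` by scalars. This gives the fusion of 1/32 with 0 and 1/4 on the
even eigenvectors. -/
theorem D_mul_mem_span {x : M t} (hx : x ∈ evenPart t) (i : Fin 3) :
    D t i * x ∈ Submodule.span ℝ {D t i} := by
  refine mul_mem_of_span ?_ (Submodule.mem_span_singleton_self _) hx
  rintro _ rfl _ ((⟨j, rfl⟩ | ⟨j, rfl⟩) | ⟨j, rfl⟩)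
  · rw [mul_comm, S_mul_D]
    split_ifs
    · exact Submodule.mem_span_singleton_self _
    · exact Submodule.smul_mem _ _ (Submodule.mem_span_singleton_self _)
  · rw [D_mul_R]
    split_ifs <;> exact Submodule.smul_mem _ _ (Submodule.mem_span_singleton_self _)
  · rw [D_mul_N]
    split_ifs
    · exact Submodule.smul_mem _ _ (Submodule.mem_span_singleton_self _)
    · exact zero_mem _

theorem S_mul_Z (i : Fin 3) (m : Fin 4) : S t i * Z t i m = 0 := by
  fin_cases m <;>
  simp [Z, mul_add, mul_sub, mul_smul_comm, S_mul_S, S_mul_R, S_mul_N, add_assoc,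
    third_self_add_one, third_self_add_two] <;>
  module

theorem S_mul_Q (i : Fin 3) (m : Fin 4) : S t i * Q t i m = (1 / 2 : ℝ) • Q t i m := by
  fin_cases m <;>
  simp [Q, mul_sub, mul_smul_comm, S_mul_S, S_mul_R, S_mul_N] <;>
  module

theorem D_mul_Z (i : Fin 3) (m : Fin 4) : D t i * Z t i m = 0 := by
  fin_cases m <;>
  simp [Z, mul_add, mul_sub, mul_smul_comm, D_mul_S, S_mul_D, D_mul_R, D_mul_N, add_assoc] <;>
  module

theorem D_mul_Q (i : Fin 3) (m : Fin 4) : D t i * Q t i m = 0 := by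
  fin_cases m <;>
  simp [Q, mul_sub, mul_smul_comm, D_mul_S, S_mul_D, D_mul_R, D_mul_N]

/-- The system is triangular: `Q` and S_i give R and N at i + 1 and i + 2, after which each `Z`
yields its one remaining basis vector. -/
theorem evenPart_le (i : Fin 3) :
    evenPart t ≤ Submodule.span ℝ ({S t i} ∪ Set.range (Z t i) ∪ Set.range (Q t i)) := by
  set p := Submodule.span ℝ ({S t i} ∪ Set.range (Z t i) ∪ Set.range (Q t i)) with hp
  have hS : S t i ∈ p := Submodule.subset_span (.inl (.inl rfl))
  have hZ : ∀ m, Z t i m ∈ p := fun m => Submodule.subset_span (.inl (.inr ⟨m, rfl⟩))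
  have hQ : ∀ m, Q t i m ∈ p := fun m => Submodule.subset_span (.inr ⟨m, rfl⟩)
  have hR1 : R t (i + 1) ∈ p := by
    simpa [Q] using add_mem (hQ 1) (p.smul_mem (1 / 2) hS)
  have hR2 : R t (i + 2) ∈ p := by
    simpa [Q] using add_mem (hQ 0) (p.smul_mem (1 / 2) hS)
  have hN1 : N t (i + 1) ∈ p := hQ 3
  have hN2 : N t (i + 2) ∈ p := hQ 2
  have hS1 : S t (i + 1) ∈ p := by
    convert sub_mem (add_mem (hZ 0) (p.smul_mem (1 / 4) hR2)) (p.smul_mem (1 / 16) hS) using 1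
    simp [Z]
    module
  have hS2 : S t (i + 2) ∈ p := by
    convert sub_mem (add_mem (hZ 1) (p.smul_mem (1 / 4) hR1)) (p.smul_mem (1 / 16) hS) using 1
    simp [Z]
    module
  have hR : R t i ∈ p := by
    convert sub_mem (sub_mem (add_mem (hZ 2) (p.smul_mem (c t / 4) (add_mem hR1 hR2)))
      (p.smul_mem (1 / 4) (add_mem hN1 hN2))) (p.smul_mem (c t / 8) hS) using 1
    simp [Z]
    module
  have hN : N t i ∈ p := by
    convert sub_mem (sub_mem (add_mem (hZ 3) (p.smul_mem ((c t ^ 2 - 1) / 4) (add_mem hR1 hR2)))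
      (p.smul_mem (c t / 4) (add_mem hN1 hN2))) (p.smul_mem ((c t ^ 2 - 1) / 8) hS) using 1
    simp [Z]
    module
  refine Submodule.span_le.2 ?_
  rintro _ ((⟨j, rfl⟩ | ⟨j, rfl⟩) | ⟨j, rfl⟩) <;>
    obtain rfl | rfl | rfl := fin_three_cases i j <;> assumption

theorem a_add_a (i : Fin 3) (s : Bool) : a t i s + a t i (!s) = S t i := by
  cases s <;> simp [S, add_comm]

theorem a_mul_a_not (i : Fin 3) (s : Bool) : a t i (!s) * a t i s = 0 := by
  rw [e_mul_e]; simp [basisMul, mulAA]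

theorem a_mul_a (i : Fin 3) (s : Bool) : a t i s * a t i s = a t i s := by
  rw [e_mul_e]; simp [basisMul, mulAA]

/-- Since a_{±i} = (S_i ± D_i)/2, a vector killed by D_i sees both axes as S_i/2: the Peirce
eigenvalues 0 and 1/2 become 0 and 1/4. -/
theorem a_mul_of_D_mul {x : M t} {i : Fin 3} {μ : ℝ} (hS : S t i * x = (2 * μ) • x)
    (hD : D t i * x = 0) (s : Bool) : a t i s * x = μ • x := by
  cases s
  · rw [a_false, smul_mul_assoc, sub_mul, hS, hD]; module
  · rw [a_true, smul_mul_assoc, add_mul, hS, hD]; module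

theorem a_mul_D {i j : Fin 3} (h : j ≠ i) (s : Bool) :
    a t i s * D t j = (1 / 32 : ℝ) • D t j := by
  refine a_mul_of_D_mul t ?_ ?_ s
  · rw [S_mul_D, if_neg h]; norm_num
  · rw [D_mul_D, if_neg h]

/-- The eigenspaces are spanned by the axis itself for 1, by the opposite axis and `Z` for 0, by `Q`
for 1/4, and by the other two `D` for 1/32. -/
theorem isAxis_a (i : Fin 3) (s : Bool) :
    IsAxis monster (a t i s) ∧ adEigenspace (a t i s) 1 = Submodule.span ℝ {a t i s} := by
  have h1 : i + 1 ≠ i := by simp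
  have h2 : i + 2 ≠ i := by simp
  have aZ : ∀ s m, a t i s * Z t i m = 0 := fun s m => by
    rw [a_mul_of_D_mul t (μ := 0) (by rw [S_mul_Z]; simp) (D_mul_Z t i m) s, zero_smul]
  have aQ : ∀ s m, a t i s * Q t i m = (1 / 4 : ℝ) • Q t i m := fun s m =>
    a_mul_of_D_mul t (by rw [S_mul_Q]; norm_num) (D_mul_Q t i m) s
  have Dev : ∀ x ∈ evenPart t, ∀ y ∈ ({D t (i + 1), D t (i + 2)} : Set (M t)),
      x * y ∈ Submodule.span ℝ ({D t (i + 1), D t (i + 2)} : Set (M t)) := by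
    rintro x hx y hy
    rw [mul_comm]
    obtain ⟨j, rfl⟩ : ∃ j, y = D t j := by rcases hy with rfl | rfl <;> exact ⟨_, rfl⟩
    exact Submodule.span_mono (Set.singleton_subset_iff.2 hy) (D_mul_mem_span t hx j)
  have hev : evenPart t ≤ Submodule.span ℝ
      ({a t i s} ∪ insert (a t i (!s)) (Set.range (Z t i)) ∪ Set.range (Q t i)) := by
    refine (evenPart_le t i).trans (Submodule.span_le.2 ?_)
    rintro _ ((rfl | ⟨m, rfl⟩) | ⟨m, rfl⟩)
    · rw [← a_add_a t i s]
      exact add_mem (Submodule.subset_span (.inl (.inl rfl)))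
        (Submodule.subset_span (.inl (.inr (.inl rfl))))
    · exact Submodule.subset_span (.inl (.inr (.inr ⟨m, rfl⟩)))
    · exact Submodule.subset_span (.inr ⟨m, rfl⟩)
  refine isAxis_of_eigenvectors (z := insert (a t i (!s)) (Set.range (Z t i)))
    (q := Set.range (Q t i)) (h := {D t (i + 1), D t (i + 2)}) (a_mul_a t i s) ?_ ?_ ?_ ?_ ?_ ?_ ?_
    ?_ ?_ ?_
  · rintro _ (rfl | ⟨m, rfl⟩)
    · rw [mul_comm, a_mul_a_not]
    · exact aZ s m
  · rintro _ ⟨m, rfl⟩; exact aQ s m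
  · rintro _ (rfl | rfl)
    · exact a_mul_D t h1 s
    · exact a_mul_D t h2 s
  · set p := Submodule.span ℝ ({a t i s} ∪ insert (a t i (!s)) (Set.range (Z t i))
      ∪ Set.range (Q t i) ∪ {D t (i + 1), D t (i + 2)}) with hp
    have hle : evenPart t ≤ p := hev.trans (Submodule.span_mono Set.subset_union_left)
    refine eq_top_of_mem (fun j => hle (S_mem_evenPart t j)) (fun j => ?_)
      (fun j => hle (R_mem_evenPart t j)) (fun j => hle (N_mem_evenPart t j))
    obtain rfl | rfl | rfl := fin_three_cases i j
    · have ha : a t j s ∈ p := Submodule.subset_span (.inl (.inl (.inl rfl)))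
      have ha' : a t j (!s) ∈ p := Submodule.subset_span (.inl (.inl (.inr (.inl rfl))))
      cases s
      · exact p.sub_mem ha' ha
      · exact p.sub_mem ha ha'
    · exact Submodule.subset_span (.inr (.inl rfl))
    · exact Submodule.subset_span (.inr (.inr rfl))
  · have ZZ : ∀ m n, Z t i m * Z t i n ∈
        Submodule.span ℝ (insert (a t i (!s)) (Set.range (Z t i))) := by
      intro m n
      refine Submodule.span_mono (Set.subset_insert _ _) ?_
      rcases le_total m n with h | h
      · exact Z_mul_Z_of_le t i m n h
      · rw [mul_comm]; exact Z_mul_Z_of_le t i n m h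
    rintro _ (rfl | ⟨m, rfl⟩) _ (rfl | ⟨n, rfl⟩)
    · rw [a_mul_a]; exact Submodule.subset_span (.inl rfl)
    · rw [aZ]; exact zero_mem _
    · rw [mul_comm, aZ]; exact zero_mem _
    · exact ZZ m n
  · rintro _ (rfl | ⟨m, rfl⟩) _ ⟨n, rfl⟩
    · rw [aQ]; exact Submodule.smul_mem _ _ (Submodule.subset_span ⟨n, rfl⟩)
    · exact Z_mul_Q t i m n
  · rintro _ (rfl | ⟨m, rfl⟩)
    · rintro _ (rfl | rfl)
      · rw [a_mul_D t h1]; exact Submodule.smul_mem _ _ (Submodule.subset_span (.inl rfl))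
      · rw [a_mul_D t h2]; exact Submodule.smul_mem _ _ (Submodule.subset_span (.inr rfl))
    · exact Dev _ (Z_mem_evenPart t i m)
  -- The Peirce 1-part ℝS_i splits into the axis (eigenvalue 1) and its opposite (eigenvalue 0), as
  -- 1/4 * 1/4 = {1, 0} requires.
  · have hle : Submodule.span ℝ (insert (S t i) (Set.range (Z t i))) ≤
        Submodule.span ℝ ({a t i s} ∪ insert (a t i (!s)) (Set.range (Z t i))) := by
      refine Submodule.span_le.2 ?_
      rintro _ (rfl | ⟨m, rfl⟩)
      · rw [← a_add_a t i s]
        exact add_mem (Submodule.subset_span (.inl rfl)) (Submodule.subset_span (.inr (.inl rfl)))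
      · exact Submodule.subset_span (.inr (.inr ⟨m, rfl⟩))
    rintro _ ⟨m, rfl⟩ _ ⟨n, rfl⟩
    rcases le_total m n with h | h
    · exact hle (Q_mul_Q_of_le t i m n h)
    · rw [mul_comm]; exact hle (Q_mul_Q_of_le t i n m h)
  · rintro _ ⟨m, rfl⟩
    exact Dev _ (Q_mem_evenPart t i m)
  -- A product of two of the `D` is even, and the even part avoids the eigenvalue 1/32.
  · intro x hx y hy
    refine hev ?_
    obtain ⟨j, rfl⟩ : ∃ j, x = D t j := by rcases hx with rfl | rfl <;> exact ⟨_, rfl⟩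
    obtain ⟨k, rfl⟩ : ∃ k, y = D t k := by rcases hy with rfl | rfl <;> exact ⟨_, rfl⟩
    rw [D_mul_D]
    split_ifs
    · exact S_mem_evenPart t j
    · exact zero_mem _

theorem e_ne_zero (p : Label) : e t p ≠ 0 := by
  intro h
  have := congrFun h p
  rw [e_apply, if_pos rfl] at this
  exact one_ne_zero this

theorem adjoin_axes : NonUnitalAlgebra.adjoin ℝ (axes t) = ⊤ := by
  set p := NonUnitalAlgebra.adjoin ℝ (axes t)
  have hs := fun (r : ℝ) (x : M t) (hx : x ∈ p) => SMulMemClass.smul_mem r hx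
  have ha : ∀ i s, a t i s ∈ p := fun i s => NonUnitalAlgebra.subset_adjoin ℝ ⟨i, s, rfl⟩
  have hv : ∀ i, v t i ∈ p := fun i => by
    have h := mul_mem (ha (i + 1) true) (ha (i + 2) true)
    -- The product formula for two axes with different indices, solved for `v`.
    have h' : v t i = (-64 / 3 : ℝ) • (a t (i + 1) true * a t (i + 2) true)
        + (1 / 3 : ℝ) • ((3 : ℝ) • a t (i + 1) true + (3 : ℝ) • a t (i + 2) true
          + a t (i + 1) false + a t (i + 2) false) := by
      rw [e_mul_e]
      simp [basisMul, mulAA, third_add_one_add_two]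
      module
    rw [h']
    exact add_mem (hs _ _ h) (hs _ _ (add_mem (add_mem (add_mem (hs _ _ (ha _ _))
      (hs _ _ (ha _ _))) (ha _ _)) (ha _ _)))
  have hw : ∀ i, w t i ∈ p := fun i => by
    have h := mul_mem (ha i true) (hv i)
    rw [e_mul_e] at h
    simpa [basisMul, mulAV] using h
  rw [eq_top_iff]
  intro x _
  rw [eq_sum_smul_e t x]
  refine sum_mem fun q _ => hs _ _ ?_
  rcases q with ⟨i, s⟩ | i | i
  · exact ha i s
  · exact hv i
  · exact hw i

theorem isPrimitiveAxialAlgebra : IsPrimitiveAxialAlgebra monster (axes t) where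
  isAxis := by rintro _ ⟨i, s, rfl⟩; exact (isAxis_a t i s).1
  isPrimitive := by rintro _ ⟨i, s, rfl⟩; exact ⟨e_ne_zero t _, (isAxis_a t i s).2⟩
  generates := adjoin_axes t

end M

/-! ### Norton's inequality for Hermitian matrices -/

section Hermitian

open Matrix ComplexOrder

variable {n ι : Type*} [Fintype n] [DecidableEq n] [Fintype ι]

/-- The real part of the trace of a complex matrix. -/
def reTrace : Matrix n n ℂ →ₗ[ℝ] ℝ := Complex.reLm ∘ₗ Matrix.traceLinearMap n ℝ ℂ

theorem reTrace_apply (X : Matrix n n ℂ) : reTrace X = X.trace.re := rfl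

theorem reTrace_mul_comm (X Y : Matrix n n ℂ) : reTrace (X * Y) = reTrace (Y * X) := by
  rw [reTrace_apply, Matrix.trace_mul_comm, reTrace_apply]

theorem reTrace_conjTranspose_mul_self_nonneg (X : Matrix n n ℂ) : 0 ≤ reTrace (Xᴴ * X) :=
  (Complex.le_def.1 (Matrix.posSemidef_conjTranspose_mul_self X).trace_nonneg).1

theorem reTrace_sq_nonneg {X : Matrix n n ℂ} (hX : X.IsHermitian) : 0 ≤ reTrace (X * X) := by
  have h := reTrace_conjTranspose_mul_self_nonneg X
  rwa [hX.eq] at h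

theorem reTrace_sq_eq_zero {X : Matrix n n ℂ} (hX : X.IsHermitian) (h : reTrace (X * X) = 0) :
    X = 0 := by
  have h1 := Complex.le_def.1 (Matrix.posSemidef_conjTranspose_mul_self X).trace_nonneg
  have h2 : (Xᴴ * X).trace = 0 := by
    refine Complex.ext ?_ h1.2.symm
    rw [hX.eq]; exact h
  exact Matrix.trace_conjTranspose_mul_self_eq_zero_iff.1 h2

/-- The trace of [X, Y]ᴴ[X, Y] is non-negative and equals 2 tr(X²Y²) - 2 tr(XYXY). -/
theorem reTrace_commutator {X Y : Matrix n n ℂ} (hX : X.IsHermitian) (hY : Y.IsHermitian) :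
    reTrace (X * Y * (X * Y)) ≤ reTrace (X * X * (Y * Y)) := by
  have h := reTrace_conjTranspose_mul_self_nonneg (X * Y - Y * X)
  have e1 : (X * Y - Y * X)ᴴ * (X * Y - Y * X)
      = Y * (X * X * Y) - Y * X * (Y * X) - X * Y * (X * Y) + X * (Y * Y * X) := by
    rw [conjTranspose_sub, conjTranspose_mul, conjTranspose_mul, hX.eq, hY.eq]
    noncomm_ring
  rw [e1, map_add, map_sub, map_sub, reTrace_mul_comm Y, reTrace_mul_comm X (Y * Y * X),
    mul_assoc Y X (Y * X), reTrace_mul_comm Y (X * (Y * X))] at h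
  have e2 : X * X * Y * Y = X * X * (Y * Y) := by noncomm_ring
  have e3 : X * (Y * X) * Y = X * Y * (X * Y) := by noncomm_ring
  have e4 : Y * Y * X * X = Y * Y * (X * X) := by noncomm_ring
  rw [e2, e3, e4, reTrace_mul_comm (Y * Y)] at h
  linarith

/-- The variance of a Hermitian matrix in a state is non-negative. -/
theorem sq_reTrace_le {P X : Matrix n n ℂ} (hP : P.IsHermitian) (hPP : P * P = P)
    (htr : reTrace P = 1) (hX : X.IsHermitian) :
    reTrace (P * X) ^ 2 ≤ reTrace (P * (X * X)) := by
  set r := reTrace (P * X) with hr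
  -- With `r` the expectation tr(PX), the trace norm of (X - r)P is the variance tr(PX²) - r².
  have h := reTrace_conjTranspose_mul_self_nonneg ((X - r • 1) * P)
  have e1 : ((X - r • 1) * P)ᴴ * ((X - r • 1) * P)
      = P * (X * X * P) - (2 * r) • (P * (X * P)) + r ^ 2 • (P * P) := by
    rw [conjTranspose_mul, conjTranspose_sub, conjTranspose_smul, conjTranspose_one, hX.eq, hP.eq,
      star_trivial]
    simp only [sub_mul, mul_sub, smul_mul_assoc, mul_smul_comm, one_mul, mul_one, mul_assoc]
    module
  have e2 : reTrace (P * (X * X * P)) = reTrace (P * (X * X)) := by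
    rw [reTrace_mul_comm, mul_assoc, hPP, reTrace_mul_comm]
  have e3 : reTrace (P * (X * P)) = r := by
    rw [reTrace_mul_comm, mul_assoc, hPP, reTrace_mul_comm]
  rw [e1, map_add, map_sub, map_smul, map_smul, e2, e3, hPP, htr] at h
  simp only [smul_eq_mul] at h
  nlinarith

/-- Norton's inequality for Hermitian matrices with the Jordan product, extended by square roots of
the projections `P i`. -/
theorem norton_hermitian {P : ι → Matrix n n ℂ} (hP : ∀ i, (P i).IsHermitian)
    (hPP : ∀ i, P i * P i = P i) (htr : ∀ i, reTrace (P i) = 1) {X Y : Matrix n n ℂ}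
    (hX : X.IsHermitian) (hY : Y.IsHermitian) (α β : ι → ℝ) :
    reTrace (((1 / 2 : ℝ) • (X * Y + Y * X) + ∑ i, (α i * β i) • P i)
        * ((1 / 2 : ℝ) • (X * Y + Y * X) + ∑ i, (α i * β i) • P i))
      + ∑ i, (reTrace (P i * X) * β i + reTrace (P i * Y) * α i) ^ 2
    ≤ reTrace ((X * X + ∑ i, (α i * α i) • P i) * (Y * Y + ∑ i, (β i * β i) • P i))
      + ∑ i, (2 * reTrace (P i * X) * α i) * (2 * reTrace (P i * Y) * β i) := by
  -- Right side minus left side is a sum of three non-negative pieces: half of tr(X²Y²) - tr(XYXY),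
  -- the variances of β_i X - α_i Y in the states P_i, and a form in the pairings tr(P_i P_j).
  have hcomm := reTrace_commutator hX hY
  have hvar : ∀ i, 0 ≤ β i ^ 2 * reTrace (P i * (X * X)) + α i ^ 2 * reTrace (P i * (Y * Y))
      - α i * β i * reTrace (P i * (X * Y + Y * X))
      - (β i * reTrace (P i * X) - α i * reTrace (P i * Y)) ^ 2 := fun i => by
    have hH : (β i • X - α i • Y).IsHermitian := by
      rw [Matrix.IsHermitian, conjTranspose_sub, conjTranspose_smul, conjTranspose_smul, hX.eq,
        hY.eq, star_trivial, star_trivial]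
    have h := sq_reTrace_le (hP i) (hPP i) (htr i) hH
    have e : P i * ((β i • X - α i • Y) * (β i • X - α i • Y)) = β i ^ 2 • (P i * (X * X))
        + α i ^ 2 • (P i * (Y * Y)) - (α i * β i) • (P i * (X * Y + Y * X)) := by
      simp only [sub_mul, mul_sub, mul_add, smul_mul_assoc, mul_smul_comm]
      module
    rw [e] at h
    simp only [mul_sub, mul_smul_comm, map_add, map_sub, map_smul, smul_eq_mul] at h ⊢
    linarith
  -- tr(P_i P_j) is the trace of (P_i P_j)ᴴ(P_i P_j) because both are projections.
  have hpair : ∀ i j, 0 ≤ reTrace (P i * P j) := fun i j => by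
    have h := reTrace_conjTranspose_mul_self_nonneg (P i * P j)
    rwa [conjTranspose_mul, (hP i).eq, (hP j).eq, reTrace_mul_comm, mul_assoc, ← mul_assoc (P j),
      hPP, reTrace_mul_comm, mul_assoc, hPP, reTrace_mul_comm] at h
  -- After symmetrising in i and j, the difference is half the sum of (α_i β_j - α_j β_i)² tr(P_i
  -- P_j).
  have hgram : ∑ i, ∑ j, (α i * β i) * (α j * β j) * reTrace (P i * P j)
      ≤ ∑ i, ∑ j, (α i * α i) * (β j * β j) * reTrace (P i * P j) := by
    have h1 : ∑ i, ∑ j, (α i * α i) * (β j * β j) * reTrace (P i * P j)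
        = ∑ i, ∑ j, (α j * α j) * (β i * β i) * reTrace (P i * P j) := by
      rw [Finset.sum_comm]
      exact Finset.sum_congr rfl fun i _ => Finset.sum_congr rfl fun j _ => by
        rw [reTrace_mul_comm (P j)]
    have h2 : ∑ i, ∑ j, ((α i * β i) * (α j * β j) * reTrace (P i * P j)
        + (α i * β i) * (α j * β j) * reTrace (P i * P j))
        ≤ ∑ i, ∑ j, ((α i * α i) * (β j * β j) * reTrace (P i * P j)
        + (α j * α j) * (β i * β i) * reTrace (P i * P j)) := by
      refine Finset.sum_le_sum fun i _ => Finset.sum_le_sum fun j _ => ?_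
      nlinarith [mul_nonneg (sq_nonneg (α i * β j - α j * β i)) (hpair i j)]
    simp only [Finset.sum_add_distrib] at h2
    linarith
  have hlin : ∀ (W : Matrix n n ℂ) (γ : ι → ℝ),
      reTrace (W * ∑ i, γ i • P i) = ∑ i, γ i * reTrace (P i * W) := fun W γ => by
    simp only [Finset.mul_sum, map_sum, mul_smul_comm, map_smul, smul_eq_mul, reTrace_mul_comm W]
  have hquad : ∀ γ δ : ι → ℝ, reTrace ((∑ i, γ i • P i) * ∑ j, δ j • P j)
      = ∑ i, ∑ j, γ i * δ j * reTrace (P i * P j) := fun γ δ => by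
    simp only [Finset.sum_mul, Finset.mul_sum, map_sum, smul_mul_assoc, mul_smul_comm, map_smul,
      smul_eq_mul]
    rw [Finset.sum_comm]
    exact Finset.sum_congr rfl fun i _ => Finset.sum_congr rfl fun j _ => by ring
  have hsum := Finset.sum_nonneg fun i (_ : i ∈ Finset.univ) => hvar i
  have eL : reTrace (((1 / 2 : ℝ) • (X * Y + Y * X) + ∑ i, (α i * β i) • P i)
        * ((1 / 2 : ℝ) • (X * Y + Y * X) + ∑ i, (α i * β i) • P i))
      = (1 / 2) * reTrace (X * Y * (X * Y)) + (1 / 2) * reTrace (X * X * (Y * Y))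
        + ∑ i, α i * β i * reTrace (P i * (X * Y + Y * X))
        + ∑ i, ∑ j, (α i * β i) * (α j * β j) * reTrace (P i * P j) := by
    have e1 : reTrace ((X * Y + Y * X) * (X * Y + Y * X))
        = 2 * reTrace (X * Y * (X * Y)) + 2 * reTrace (X * X * (Y * Y)) := by
      have e2 : reTrace (Y * X * (Y * X)) = reTrace (X * Y * (X * Y)) := by
        rw [mul_assoc, reTrace_mul_comm]; congr 1; noncomm_ring
      have e3 : reTrace (X * Y * (Y * X)) = reTrace (X * X * (Y * Y)) := by
        rw [mul_assoc, reTrace_mul_comm, reTrace_mul_comm (X * X)]; congr 1; noncomm_ring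
      have e4 : reTrace (Y * X * (X * Y)) = reTrace (X * X * (Y * Y)) := by
        rw [mul_assoc, reTrace_mul_comm]; congr 1; noncomm_ring
      rw [add_mul, mul_add, mul_add, map_add, map_add, map_add, e2, e3, e4]
      ring
    rw [add_mul, mul_add, mul_add, map_add, map_add, map_add, hquad, hlin,
      reTrace_mul_comm (∑ i, _), hlin]
    simp only [mul_smul_comm, smul_mul_assoc, map_smul, smul_eq_mul, e1]
    have e6 : ∑ i, α i * β i * (1 / 2 * reTrace (P i * (X * Y + Y * X)))
        = 1 / 2 * ∑ i, α i * β i * reTrace (P i * (X * Y + Y * X)) := by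
      rw [Finset.mul_sum]
      exact Finset.sum_congr rfl fun i _ => by ring
    rw [e6]
    ring
  have eR : reTrace ((X * X + ∑ i, (α i * α i) • P i) * (Y * Y + ∑ i, (β i * β i) • P i))
      = reTrace (X * X * (Y * Y)) + ∑ i, β i ^ 2 * reTrace (P i * (X * X))
        + ∑ i, α i ^ 2 * reTrace (P i * (Y * Y))
        + ∑ i, ∑ j, (α i * α i) * (β j * β j) * reTrace (P i * P j) := by
    rw [add_mul, mul_add, mul_add, map_add, map_add, map_add, hquad, hlin,
      reTrace_mul_comm (∑ i, _), hlin]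
    simp only [sq]
    ring
  rw [eL, eR]
  -- The contributions of the square-root coordinates combine to the squared means that complete the
  -- variances in `hvar`.
  have e5 : ∑ i, (2 * reTrace (P i * X) * α i) * (2 * reTrace (P i * Y) * β i)
      - ∑ i, (reTrace (P i * X) * β i + reTrace (P i * Y) * α i) ^ 2
      = - ∑ i, (β i * reTrace (P i * X) - α i * reTrace (P i * Y)) ^ 2 := by
    rw [← Finset.sum_sub_distrib, ← Finset.sum_neg_distrib]
    exact Finset.sum_congr rfl fun i _ => by ring
  simp only [Finset.sum_sub_distrib, Finset.sum_add_distrib] at hsum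
  linarith

end Hermitian

namespace M

variable (t : ℝ)

/-! ### The form in the basis `S, D, R, N` -/

theorem form_symm (x y : M t) : form t x y = form t y x := by
  have hg : ∀ p q, gram t p q = gram t q p := by
    rintro (⟨i, s⟩ | i | i) (⟨j, r⟩ | j | j) <;> simp [gram, eq_comm]
  rw [form_apply, form_apply, Finset.sum_comm]
  exact Finset.sum_congr rfl fun p _ => Finset.sum_congr rfl fun q _ => by rw [hg, mul_comm (x _)]

theorem form_S_S (i j : Fin 3) : form t (S t i) (S t j) = if j = i then 2 else 1 / 8 := by
  obtain rfl | rfl | rfl := fin_three_cases i j <;>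
  simp [S, form_e_e, gram] <;> norm_num

theorem form_S_D (i j : Fin 3) : form t (S t i) (D t j) = 0 := by
  obtain rfl | rfl | rfl := fin_three_cases i j <;>
  simp [S, D, form_e_e, gram]

theorem form_D_D (i j : Fin 3) : form t (D t i) (D t j) = if j = i then 2 else 0 := by
  obtain rfl | rfl | rfl := fin_three_cases i j <;>
  simp [D, form_e_e, gram] ; norm_num

theorem form_S_R (i j : Fin 3) : form t (S t i) (R t j) = if j = i then c t / 4 else 1 := by
  obtain rfl | rfl | rfl := fin_three_cases i j <;>
  simp [R, S, form_e_e, gram, add_assoc, c] <;> ring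

theorem form_D_R (i j : Fin 3) : form t (D t i) (R t j) = 0 := by
  obtain rfl | rfl | rfl := fin_three_cases i j <;>
  simp [D, R, S, form_e_e, gram, add_assoc]

theorem form_R_R (i j : Fin 3) :
    form t (R t i) (R t j) = if j = i then 17 / 4 else 1 / 4 + c t := by
  obtain rfl | rfl | rfl := fin_three_cases i j <;>
  simp [R, S, form_e_e, gram, add_assoc, c] <;> ring

theorem form_S_N (i j : Fin 3) :
    form t (S t i) (N t j) = if j = i then (c t ^ 2 - 1) / 4 else 0 := by
  obtain rfl | rfl | rfl := fin_three_cases i j <;>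
  simp [N, D, S, form_e_e, gram, gramAW, add_assoc, c] <;> ring

theorem form_D_N (i j : Fin 3) : form t (D t i) (N t j) = 0 := by
  obtain rfl | rfl | rfl := fin_three_cases i j <;>
  simp [N, D, S, form_e_e, gram, gramAW, add_assoc] <;> ring

theorem form_R_N (i j : Fin 3) :
    form t (R t i) (N t j) = if j = i then 0 else c t ^ 2 - 1 := by
  obtain rfl | rfl | rfl := fin_three_cases i j <;>
  simp [R, N, D, S, form_e_e, gram, gramAW, add_assoc, c] <;> ring

/-- Every pairing with `N` carries the factor 1 - c² or vanishes. Hence `N` lies in the radical when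
c² = 1, and the diagonal value obstructs positivity when c² ≥ 1. -/
theorem form_N_N (i j : Fin 3) : form t (N t i) (N t j) =
    if j = i then 15 / 4 * (1 - c t ^ 2) else (1 / 4 - c t) * (1 - c t ^ 2) := by
  obtain rfl | rfl | rfl := fin_three_cases i j <;>
  simp [N, D, S, form_e_e, gram, gramAW, add_assoc, c] <;> ring

/-! ### Linear maps out of `M t` -/

/-- The linear map with prescribed values on the basis of `M t`. -/
def lift {E : Type*} [AddCommGroup E] [Module ℝ E] (f : Label → E) : M t →ₗ[ℝ] E where
  toFun x := ∑ p, x p • f p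
  map_add' x y := by simp only [add_apply, add_smul, Finset.sum_add_distrib]
  map_smul' r x := by simp only [smul_apply, mul_smul, Finset.smul_sum, RingHom.id_apply]

theorem lift_e {E : Type*} [AddCommGroup E] [Module ℝ E] (f : Label → E) (p : Label) :
    lift t f (e t p) = f p := by
  change ∑ q, (e t p) q • f q = f p
  simp [e_apply]

/-- Bilinear induction: a relation that is compatible with the linear structure holds everywhere
if it holds on the basis `S, D, R, N`. -/
theorem induction₂ {P : M t → M t → Prop} (symm : ∀ x y, P x y → P y x) (zero : ∀ y, P 0 y)
    (add : ∀ x x' y, P x y → P x' y → P (x + x') y)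
    (smul : ∀ (r : ℝ) x y, P x y → P (r • x) y)
    (SS : ∀ i j, P (S t i) (S t j)) (SD : ∀ i j, P (S t i) (D t j))
    (SR : ∀ i j, P (S t i) (R t j)) (SN : ∀ i j, P (S t i) (N t j))
    (DD : ∀ i j, P (D t i) (D t j)) (DR : ∀ i j, P (D t i) (R t j))
    (DN : ∀ i j, P (D t i) (N t j)) (RR : ∀ i j, P (R t i) (R t j))
    (RN : ∀ i j, P (R t i) (N t j)) (NN : ∀ i j, P (N t i) (N t j)) (x y : M t) : P x y := by
  let p : M t → Submodule ℝ (M t) := fun y =>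
    { carrier := {x | P x y}
      add_mem' := fun hx hx' => add _ _ _ hx hx'
      zero_mem' := zero y
      smul_mem' := fun r _ hx => smul r _ _ hx }
  have hp : ∀ y, (∀ i, P (S t i) y) → (∀ i, P (D t i) y) → (∀ i, P (R t i) y) →
      (∀ i, P (N t i) y) → ∀ x, P x y := fun y hS hD hR hN x => by
    have h : p y = ⊤ := eq_top_of_mem hS hD hR hN
    exact (h ▸ Submodule.mem_top : x ∈ p y)
  refine hp y ?_ ?_ ?_ ?_ x <;> intro i <;> refine symm _ _ (hp _ ?_ ?_ ?_ ?_ y) <;> intro j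
  · exact SS j i
  · exact symm _ _ (SD i j)
  · exact symm _ _ (SR i j)
  · exact symm _ _ (SN i j)
  · exact SD j i
  · exact DD j i
  · exact symm _ _ (DR i j)
  · exact symm _ _ (DN i j)
  · exact SR j i
  · exact DR j i
  · exact RR j i
  · exact symm _ _ (RN i j)
  · exact SN j i
  · exact DN j i
  · exact RN j i
  · exact NN j i

end M

namespace M

open Matrix

variable (t : ℝ)

/-! ### The matrix model -/

/-- The coordinate along `D i`. -/
def dCoord (i : Fin 3) : M t →ₗ[ℝ] ℝ := lift t fun p => match p with
  | .a j s => if j = i then (if s then 1 / 2 else -1 / 2) else 0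
  | .v _ => 0
  -- The coefficient of `D j` in `w_eq`.
  | .w j => if j = i then t / 2 else 0

theorem dCoord_S (i j : Fin 3) : dCoord t i (S t j) = 0 := by
  by_cases h : j = i <;> simp [S, dCoord, lift_e, h]; norm_num

theorem dCoord_D (i j : Fin 3) : dCoord t i (D t j) = if j = i then 1 else 0 := by
  simp only [D, map_sub, dCoord, lift_e]; split_ifs <;> simp_all; norm_num

theorem dCoord_R (i j : Fin 3) : dCoord t i (R t j) = 0 := by
  simp only [R, map_sub, map_add, map_smul, dCoord_S]; simp [dCoord, lift_e]

theorem dCoord_N (i j : Fin 3) : dCoord t i (N t j) = 0 := by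
  have hw : ∀ k, dCoord t i (w t k) = (t / 2) * dCoord t i (D t k) := fun k => by
    rw [dCoord_D]; simp [dCoord, lift_e]
  have hv : ∀ k, dCoord t i (v t k) = 0 := fun k => by simp [dCoord, lift_e]
  simp only [N, map_sub, map_add, map_smul, dCoord_S, hw, hv, smul_eq_mul]; ring

/-- Only even times odd contributes to the odd part, and an even x scales D_i by ⟨S_i, x⟩/2; odd
elements are orthogonal to S_i, so the formula holds for all x. -/
theorem dCoord_mul (i : Fin 3) (x y : M t) : dCoord t i (x * y)
    = form t (S t i) x / 2 * dCoord t i y + form t (S t i) y / 2 * dCoord t i x := by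
  refine induction₂ t (P := fun x y => dCoord t i (x * y)
    = form t (S t i) x / 2 * dCoord t i y + form t (S t i) y / 2 * dCoord t i x)
    ?_ ?_ ?_ ?_ ?_ ?_ ?_ ?_ ?_ ?_ ?_ ?_ ?_ ?_ x y
  · intro x y h; rw [mul_comm, h]; ring
  · intro y; simp
  · intro x x' y h h'; simp only [add_mul, map_add, h, h']; ring
  · intro r x y h; simp only [smul_mul_assoc, map_smul, h, smul_eq_mul]; ring
  all_goals
    intro j k
    simp only [S_mul_S, S_mul_D, S_mul_R, S_mul_N, D_mul_D, D_mul_R, D_mul_N, R_mul_R, R_mul_N,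
      N_mul_N, form_S_S, form_S_D, form_S_R, form_S_N]
    simp only [apply_ite (dCoord t i), map_add, map_sub, map_smul, dCoord_S, dCoord_D, dCoord_R,
      dCoord_N, map_zero, smul_eq_mul]
    grind

/-- The Gram matrix of three unit vectors with cyclic inner products `ω / 4`. -/
def gramMatrix (ω : ℂ) : Matrix (Fin 3) (Fin 3) ℂ :=
  !![1, ω / 4, ω⁻¹ / 4; ω⁻¹ / 4, 1, ω / 4; ω / 4, ω⁻¹ / 4, 1]

theorem gramMatrix_self (ω : ℂ) (i : Fin 3) : gramMatrix ω i i = 1 := by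
  fin_cases i <;> rfl
theorem gramMatrix_self_add_one (ω : ℂ) (i : Fin 3) : gramMatrix ω i (i + 1) = ω / 4 := by
  fin_cases i <;> rfl
theorem gramMatrix_self_add_two (ω : ℂ) (i : Fin 3) : gramMatrix ω i (i + 2) = ω⁻¹ / 4 := by
  fin_cases i <;> rfl
theorem gramMatrix_add_one_self (ω : ℂ) (i : Fin 3) : gramMatrix ω (i + 1) i = ω⁻¹ / 4 := by
  fin_cases i <;> rfl
theorem gramMatrix_add_two_self (ω : ℂ) (i : Fin 3) : gramMatrix ω (i + 2) i = ω / 4 := by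
  fin_cases i <;> rfl
theorem gramMatrix_add_one_add_two (ω : ℂ) (i : Fin 3) :
    gramMatrix ω (i + 1) (i + 2) = ω / 4 := by
  fin_cases i <;> rfl
theorem gramMatrix_add_two_add_one (ω : ℂ) (i : Fin 3) :
    gramMatrix ω (i + 2) (i + 1) = ω⁻¹ / 4 := by
  fin_cases i <;> rfl

/-- The elementary matrices. -/
def E (i j : Fin 3) : Matrix (Fin 3) (Fin 3) ℂ := Matrix.single i j 1

theorem E_mul_mul_E (g : Matrix (Fin 3) (Fin 3) ℂ) (i j k l : Fin 3) :
    E i j * g * E k l = g j k • E i l := by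
  rw [E, E, Matrix.single_mul_mul_single, E, Matrix.smul_single]
  simp

theorem trace_E_mul_mul (g : Matrix (Fin 3) (Fin 3) ℂ) (i j k l : Fin 3) :
    (E i j * g * (E k l * g)).trace = g j k * g l i := by
  rw [← mul_assoc, E_mul_mul_E, smul_mul_assoc, Matrix.trace_smul, E, Matrix.trace_single_mul]
  simp

/-- The matrix with entries `z` and `z'` at the positions `(i + 1, i + 2)` and `(i + 2, i + 1)`. -/
def edge (z z' : ℂ) (i : Fin 3) : Matrix (Fin 3) (Fin 3) ℂ :=
  z • E (i + 1) (i + 2) + z' • E (i + 2) (i + 1)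

/-- With c = (ω³ + ω⁻³)/2, the factor (ω³ - ω⁻³)/2 squares to c² - 1. The opposite signs make the
matrix independent of the image of `R` whenever this factor is nonzero. -/
def toMatrixN (ω : ℂ) : Fin 3 → Matrix (Fin 3) (Fin 3) ℂ :=
  edge ((ω ^ 3 - ω⁻¹ ^ 3) / 2 * ω) (-((ω ^ 3 - ω⁻¹ ^ 3) / 2 * ω⁻¹))

def toMatrixV (ω : ℂ) (i : Fin 3) : Matrix (Fin 3) (Fin 3) ℂ :=
  (2 / 3 : ℝ) • (E (i + 1) (i + 1) + E (i + 2) (i + 2) - edge ω ω⁻¹ i)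

/-- The representation of `M t` by matrices, with `D i ↦ 0`. -/
def toMatrix (ω : ℂ) : M t →ₗ[ℝ] Matrix (Fin 3) (Fin 3) ℂ := lift t fun p => match p with
  | .a i _ => (1 / 2 : ℝ) • E i i
  | .v i => toMatrixV ω i
  | .w i => (1 / 24 : ℝ) • (toMatrixN ω (i + 1) + toMatrixN ω (i + 2))
    - (3 * t / 4) • (toMatrixV ω (i + 1) + toMatrixV ω (i + 2))
    + (t / 2) • ((2 : ℝ) • E i i + E (i + 1) (i + 1) + E (i + 2) (i + 2))

theorem toMatrix_S (ω : ℂ) (i : Fin 3) : toMatrix t ω (S t i) = E i i := by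
  simp only [S, map_add, toMatrix, lift_e]; module

theorem toMatrix_D (ω : ℂ) (i : Fin 3) : toMatrix t ω (D t i) = 0 := by
  simp only [D, map_sub, toMatrix, lift_e]; module

theorem toMatrix_R (ω : ℂ) (i : Fin 3) : toMatrix t ω (R t i) = edge ω ω⁻¹ i := by
  simp only [R, map_add, map_sub, map_smul, toMatrix_S]
  simp only [toMatrix, lift_e, toMatrixV]; module

theorem toMatrix_N (ω : ℂ) (i : Fin 3) : toMatrix t ω (N t i) = toMatrixN ω i := by
  simp only [N, map_add, map_sub, map_smul, toMatrix_S, toMatrix_D]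
  simp only [toMatrix, lift_e, toMatrixV, add_assoc, Fin.reduceAdd, add_zero]
  module

variable {t}

/-- The matrix model at parameter `ω` represents `M t`. -/
def IsModel (t : ℝ) (ω : ℂ) : Prop := ω ≠ 0 ∧ (c t : ℂ) = (ω ^ 3 + ω⁻¹ ^ 3) / 2

/-- The even part multiplies by the Jordan product twisted by the Gram matrix; the sum accounts for
D_i² = S_i, as the model itself forgets `D`. -/
theorem toMatrix_mul {ω : ℂ} (h : IsModel t ω) (x y : M t) : toMatrix t ω (x * y)
    = (1 / 2 : ℝ) • (toMatrix t ω x * gramMatrix ω * toMatrix t ω y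
      + toMatrix t ω y * gramMatrix ω * toMatrix t ω x)
      + ∑ i, (dCoord t i x * dCoord t i y) • E i i := by
  have h0 := h.1
  refine induction₂ t (P := fun x y => toMatrix t ω (x * y)
    = (1 / 2 : ℝ) • (toMatrix t ω x * gramMatrix ω * toMatrix t ω y
      + toMatrix t ω y * gramMatrix ω * toMatrix t ω x)
      + ∑ i, (dCoord t i x * dCoord t i y) • E i i) ?_ ?_ ?_ ?_ ?_ ?_ ?_ ?_ ?_ ?_ ?_ ?_ ?_ ?_ x y
  · intro x y h
    simp only [mul_comm y x, h, mul_comm (dCoord t _ y), add_comm (toMatrix t ω y * _ * _)]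
  · intro y; simp
  · intro x x' y h h'
    simp only [add_mul, mul_add, map_add, h, h', add_smul, Finset.sum_add_distrib]
    module
  · intro r x y h
    simp only [smul_mul_assoc, mul_smul_comm, map_smul, h, smul_eq_mul, mul_assoc, mul_smul,
      smul_add, Finset.smul_sum]
    module
  all_goals
    intro i j
    simp only [S_mul_S, S_mul_D, S_mul_R, S_mul_N, D_mul_D, D_mul_R, D_mul_N, R_mul_R, R_mul_N,
      N_mul_N, apply_ite (toMatrix t ω), map_add, map_sub, map_smul, toMatrix_S, toMatrix_D,
      toMatrix_R, toMatrix_N, dCoord_S, dCoord_D, dCoord_R, dCoord_N, toMatrixN, edge, map_zero]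
    obtain rfl | rfl | rfl := fin_three_cases i j
  all_goals
    simp [add_mul, mul_add, smul_mul_assoc, mul_smul_comm, E_mul_mul_E, third_self_add_one,
      third_self_add_two, add_assoc, gramMatrix_self, gramMatrix_self_add_one,
      gramMatrix_self_add_two, gramMatrix_add_one_self, gramMatrix_add_two_self,
      gramMatrix_add_one_add_two, gramMatrix_add_two_add_one]
  -- The coefficients of the matrix units are compared, and `h.2` rewrites c in terms of ω, leaving
  -- rational identities in ω.
  all_goals match_scalars
  all_goals simp [h.2]
  all_goals field_simp
  all_goals ring

theorem form_eq_trace {ω : ℂ} (h : IsModel t ω) (x y : M t) : (form t x y : ℂ)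
    = 2 * (toMatrix t ω x * gramMatrix ω * (toMatrix t ω y * gramMatrix ω)).trace
      + 2 * ∑ i, (dCoord t i x * dCoord t i y : ℝ) := by
  have h0 := h.1
  refine induction₂ t (P := fun x y => (form t x y : ℂ)
    = 2 * (toMatrix t ω x * gramMatrix ω * (toMatrix t ω y * gramMatrix ω)).trace
      + 2 * ∑ i, (dCoord t i x * dCoord t i y : ℝ)) ?_ ?_ ?_ ?_ ?_ ?_ ?_ ?_ ?_ ?_ ?_ ?_ ?_ ?_ x y
  · intro x y h
    rw [form_symm, h, Matrix.trace_mul_comm]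
    simp only [mul_comm (dCoord t _ y)]
  · intro y; simp
  · intro x x' y h h'
    simp only [map_add, LinearMap.add_apply, Complex.ofReal_add, h, h', add_mul, Matrix.trace_add,
      Finset.sum_add_distrib]
    ring
  · intro r x y h
    simp only [map_smul, LinearMap.smul_apply, smul_mul_assoc, Matrix.trace_smul, smul_eq_mul,
      Complex.ofReal_mul, h, Complex.real_smul, mul_assoc, ← Finset.mul_sum]
    ring
  all_goals
    intro i j
    simp only [form_S_S, form_S_D, form_S_R, form_S_N, form_D_D, form_D_R, form_D_N, form_R_R,
      form_R_N, form_N_N, toMatrix_S, toMatrix_D,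
      toMatrix_R, toMatrix_N, dCoord_S, dCoord_D, dCoord_R, dCoord_N, toMatrixN, edge]
    obtain rfl | rfl | rfl := fin_three_cases i j
  all_goals
    simp [add_mul, mul_add, smul_mul_assoc, mul_smul_comm, trace_E_mul_mul, Matrix.trace_add,
      Matrix.trace_smul, Matrix.trace_neg, Matrix.trace_sub, add_assoc, gramMatrix_self, gramMatrix_self_add_one,
      gramMatrix_self_add_two, gramMatrix_add_one_self, gramMatrix_add_two_self,
      gramMatrix_add_one_add_two, gramMatrix_add_two_add_one, h.2]
  all_goals field_simp
  all_goals ring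

end M

/-! ### Existence of the parameter ω, and associativity of the form for every t. -/

namespace M

open Matrix ComplexConjugate ComplexOrder MatrixOrder

variable {t : ℝ}

/-- With s² = c² - 1, the numbers c + s and c - s are inverse to each other with mean c; ω is a cube
root of the first. -/
theorem exists_isModel (t : ℝ) : ∃ ω, IsModel t ω := by
  obtain ⟨s, hs⟩ := IsAlgClosed.exists_pow_nat_eq ((c t : ℂ) ^ 2 - 1) (n := 2) (by norm_num)
  have h1 : ((c t : ℂ) + s) * (c t - s) = 1 := by linear_combination -hs
  obtain ⟨ω, hω⟩ := IsAlgClosed.exists_pow_nat_eq ((c t : ℂ) + s) (n := 3) (by norm_num)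
  refine ⟨ω, ?_, ?_⟩
  · rintro rfl
    rw [← hω] at h1
    simp at h1
  · rw [inv_pow, hω, inv_eq_of_mul_eq_one_right h1]
    ring

/-- The bounds on t say |c| ≤ 1, so c = cos θ and ω = exp(iθ/3). -/
theorem exists_isModel_unitary (h0 : 0 ≤ t) (h1 : t ≤ 1 / 6) :
    ∃ ω, IsModel t ω ∧ conj ω = ω⁻¹ := by
  set θ := Real.arccos (c t) with hθ
  have hc : (c t : ℂ) = Complex.cos θ := by
    rw [← Complex.ofReal_cos, hθ, Real.cos_arccos] <;> unfold c <;> linarith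
  refine ⟨Complex.exp ((θ / 3 : ℝ) * Complex.I), ⟨Complex.exp_ne_zero _, ?_⟩, ?_⟩
  · rw [hc, Complex.cos, ← Complex.exp_neg, ← Complex.exp_nat_mul, ← Complex.exp_nat_mul]
    congr 3 <;> push_cast <;> ring_nf
  · rw [← Complex.exp_conj, ← Complex.exp_neg]
    rw [map_mul, Complex.conj_ofReal, Complex.conj_I, mul_neg]

theorem half_form_S_eq_trace {ω : ℂ} (h : IsModel t ω) (i : Fin 3) (x : M t) :
    ((form t (S t i) x / 2 : ℝ) : ℂ)
      = (E i i * gramMatrix ω * (toMatrix t ω x * gramMatrix ω)).trace := by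
  rw [Complex.ofReal_div, form_eq_trace h, toMatrix_S]
  simp [dCoord_S]

/-- The right side is invariant under all permutations of u, v, w because the trace is cyclic, which
is exactly the associativity of the form. -/
theorem form_mul_eq_trace {ω : ℂ} (h : IsModel t ω) (u v w : M t) : (form t u (v * w) : ℂ)
    = (toMatrix t ω u * gramMatrix ω * (toMatrix t ω v * gramMatrix ω)
        * (toMatrix t ω w * gramMatrix ω)).trace
      + (toMatrix t ω u * gramMatrix ω * (toMatrix t ω w * gramMatrix ω)
        * (toMatrix t ω v * gramMatrix ω)).trace
      + ∑ i, (form t (S t i) u * dCoord t i v * dCoord t i w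
        + form t (S t i) v * dCoord t i w * dCoord t i u
        + form t (S t i) w * dCoord t i v * dCoord t i u : ℝ) := by
  have e1 : (toMatrix t ω u * gramMatrix ω * (toMatrix t ω (v * w) * gramMatrix ω)).trace
      = (1 / 2) * ((toMatrix t ω u * gramMatrix ω * (toMatrix t ω v * gramMatrix ω)
        * (toMatrix t ω w * gramMatrix ω)).trace
      + (toMatrix t ω u * gramMatrix ω * (toMatrix t ω w * gramMatrix ω)
        * (toMatrix t ω v * gramMatrix ω)).trace)
      + ∑ i, (form t (S t i) u / 2 * (dCoord t i v * dCoord t i w) : ℝ) := by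
    rw [toMatrix_mul h]
    simp only [add_mul, mul_add, smul_mul_assoc, mul_smul_comm, Matrix.trace_add,
      Matrix.trace_smul, Finset.sum_mul, Finset.mul_sum, Matrix.trace_sum, Complex.real_smul, Complex.ofReal_sum]
    congr 1
    · simp only [mul_assoc]; push_cast; ring
    · refine Finset.sum_congr rfl fun i _ => ?_
      rw [Complex.ofReal_mul (_ / 2), half_form_S_eq_trace h, Matrix.trace_mul_comm, mul_comm,
        Complex.ofReal_mul]
  have e2 : ∑ i, (form t (S t i) u * dCoord t i v * dCoord t i w
        + form t (S t i) v * dCoord t i w * dCoord t i u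
        + form t (S t i) w * dCoord t i v * dCoord t i u)
      = 2 * ∑ i, (form t (S t i) u / 2 * (dCoord t i v * dCoord t i w))
        + 2 * ∑ i, (dCoord t i u * dCoord t i (v * w)) := by
    rw [Finset.mul_sum, Finset.mul_sum, ← Finset.sum_add_distrib]
    refine Finset.sum_congr rfl fun i _ => ?_
    rw [dCoord_mul]
    ring
  rw [form_eq_trace h, e1, e2, Complex.ofReal_add, Complex.ofReal_mul, Complex.ofReal_mul,
    Complex.ofReal_ofNat]
  ring

theorem isFrobeniusForm (t : ℝ) : IsFrobeniusForm (axes t) (form t) where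
  ne_zero h := by
    have := form_e_e t (.a 0 true) (.a 0 true)
    rw [h] at this
    simp [gram] at this
  assoc u v w := by
    obtain ⟨ω, h⟩ := exists_isModel t
    apply Complex.ofReal_injective
    rw [form_symm t (u * v), form_mul_eq_trace h, form_mul_eq_trace h]
    have e1 : ∀ X Y Z : Matrix (Fin 3) (Fin 3) ℂ, (X * Y * Z).trace = (Z * X * Y).trace :=
      fun X Y Z => by rw [Matrix.trace_mul_comm, mul_assoc]
    rw [e1 (toMatrix t ω u * _) (toMatrix t ω v * _), e1 (toMatrix t ω u * _),
      e1 (toMatrix t ω v * _)]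
    congr 2
    exact Finset.sum_congr rfl fun i _ => by ring
  norm_axis := by
    rintro _ ⟨i, s, rfl⟩
    rw [form_e_e]; simp [gram]

/-! ### Positivity and Norton's inequality for `0 ≤ t ≤ 1 / 6` -/

/-- For `R` the two entries ω and ω⁻¹ are conjugate. For `N` the factor (ω³ - ω⁻³)/2 is purely
imaginary, which accounts for the minus sign in `toMatrixN`. -/
theorem isHermitian_toMatrix {ω : ℂ} (hω : conj ω = ω⁻¹) (x : M t) :
    (toMatrix t ω x).IsHermitian := by
  have hω' : conj ω⁻¹ = ω := by rw [map_inv₀, hω, inv_inv]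
  have hE : ∀ i j, (E i j)ᴴ = E j i := fun i j => by simp [E, Matrix.conjTranspose_single]
  let p : Submodule ℝ (M t) :=
    { carrier := {x | (toMatrix t ω x)ᴴ = toMatrix t ω x}
      add_mem' := fun {x y} hx hy => by
        simp only [Set.mem_ofPred_eq] at hx hy ⊢
        rw [map_add, Matrix.conjTranspose_add, hx, hy]
      zero_mem' := by simp
      smul_mem' := fun r x hx => by
        simp only [Set.mem_ofPred_eq] at hx ⊢
        rw [map_smul, Matrix.conjTranspose_smul, hx, star_trivial] }
  have hp : p = ⊤ := by
    refine eq_top_of_mem (fun i => ?_) (fun i => ?_) (fun i => ?_) fun i => ?_ <;>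
      change (toMatrix t ω _)ᴴ = toMatrix t ω _
    · rw [toMatrix_S, hE]
    · rw [toMatrix_D, Matrix.conjTranspose_zero]
    · rw [toMatrix_R, edge, Matrix.conjTranspose_add, Matrix.conjTranspose_smul,
        Matrix.conjTranspose_smul, hE, hE, Complex.star_def, hω, hω', add_comm]
    · rw [toMatrix_N, toMatrixN, edge, Matrix.conjTranspose_add, Matrix.conjTranspose_smul,
        Matrix.conjTranspose_smul, hE, hE, Complex.star_def, add_comm]
      simp only [map_mul, map_neg, map_div₀, map_sub, map_pow, hω, hω', Complex.conj_ofNat]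
      congr 2 <;> ring
  exact (hp ▸ Submodule.mem_top : x ∈ p)

theorem posDef_gramMatrix {ω : ℂ} (h0 : ω ≠ 0) (hω : conj ω = ω⁻¹) : (gramMatrix ω).PosDef := by
  -- Chosen so that CᴴC has 2 on the diagonal and ω, ω⁻¹ off it: the Gram matrix is then 1/2 plus a
  -- positive semidefinite matrix.
  let C : Matrix (Fin 3) (Fin 3) ℂ := !![0, 1, ω; ω, 0, 1; 1, ω, 0]
  have h : gramMatrix ω = (1 / 2 : ℝ) • (1 : Matrix (Fin 3) (Fin 3) ℂ) + (1 / 4 : ℝ) • (Cᴴ * C) := by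
    ext i j
    fin_cases i <;> fin_cases j <;>
      simp [gramMatrix, C, Matrix.mul_apply, Fin.sum_univ_three, hω, h0] <;> ring
  rw [h]
  exact (Matrix.PosDef.one.smul (by norm_num)).add_posSemidef
    ((Matrix.posSemidef_conjTranspose_mul_self C).smul (by norm_num))

/-- For `0 ≤ t ≤ 1 / 6`, the algebra `M t` maps to Hermitian matrices with the Jordan product,
extended by square roots of three projections. -/
theorem exists_hermitian_model (h0 : 0 ≤ t) (h1 : t ≤ 1 / 6) :
    ∃ (f : M t →ₗ[ℝ] Matrix (Fin 3) (Fin 3) ℂ) (P : Fin 3 → Matrix (Fin 3) (Fin 3) ℂ) (ω : ℂ),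
      IsModel t ω ∧ (∀ x, f x = 0 → toMatrix t ω x = 0) ∧
      (∀ x, (f x).IsHermitian) ∧ (∀ i, (P i).IsHermitian) ∧ (∀ i, P i * P i = P i) ∧
      (∀ i, reTrace (P i) = 1) ∧
      (∀ x y, f (x * y) = (1 / 2 : ℝ) • (f x * f y + f y * f x)
        + ∑ i, (dCoord t i x * dCoord t i y) • P i) ∧
      (∀ i x, form t (S t i) x / 2 = reTrace (P i * f x)) ∧
      ∀ x y, form t x y = 2 * (reTrace (f x * f y) + ∑ i, dCoord t i x * dCoord t i y) := by
  obtain ⟨ω, hm, hω⟩ := exists_isModel_unitary h0 h1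
  have hg := posDef_gramMatrix hm.1 hω
  -- With g = KᴴK, the map X ↦ KXKᴴ sends the twisted product XgY to the ordinary one and preserves
  -- Hermitian matrices; the E_ii become projections since g has unit diagonal.
  obtain ⟨K, hK⟩ := CStarAlgebra.nonneg_iff_eq_star_mul_self.1 hg.posSemidef.nonneg
  rw [Matrix.star_eq_conjTranspose] at hK
  let F : Matrix (Fin 3) (Fin 3) ℂ →ₗ[ℝ] Matrix (Fin 3) (Fin 3) ℂ :=
    LinearMap.mulRight ℝ Kᴴ ∘ₗ LinearMap.mulLeft ℝ K
  have hF : ∀ X, F X = K * X * Kᴴ := fun X => rfl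
  have hFmul : ∀ X Y, F X * F Y = F (X * gramMatrix ω * Y) := fun X Y => by
    simp only [hF, hK, mul_assoc]
  have hFtr : ∀ X, (F X).trace = (X * gramMatrix ω).trace := fun X => by
    rw [hF, Matrix.trace_mul_comm, ← mul_assoc, ← hK, Matrix.trace_mul_comm]
  have hFH : ∀ X : Matrix (Fin 3) (Fin 3) ℂ, X.IsHermitian → (F X).IsHermitian := fun X hX =>
    Matrix.isHermitian_mul_mul_conjTranspose K hX
  have hE : ∀ i, (E i i).IsHermitian := fun i => by
    simp [E, Matrix.IsHermitian, Matrix.conjTranspose_single]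
  have htr : ∀ x y, (F (toMatrix t ω x) * F (toMatrix t ω y)).trace
      = (toMatrix t ω x * gramMatrix ω * (toMatrix t ω y * gramMatrix ω)).trace := fun x y => by
    rw [hFmul, hFtr, mul_assoc]
  refine ⟨F ∘ₗ toMatrix t ω, fun i => F (E i i), ω, hm, fun x hx => ?_,
    fun x => hFH _ (isHermitian_toMatrix hω x), fun i => hFH _ (hE i), fun i => ?_, fun i => ?_,
    fun x y => ?_, fun i x => ?_, fun x y => ?_⟩
  · rw [LinearMap.comp_apply, hF] at hx
    -- Multiplying KXKᴴ = 0 by Kᴴ and K gives gXg = 0, and g is invertible.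
    have h : gramMatrix ω * toMatrix t ω x * gramMatrix ω = 0 := by
      have h : Kᴴ * (K * toMatrix t ω x * Kᴴ) * K = 0 := by rw [hx]; simp
      rw [hK]
      simpa only [mul_assoc] using h
    have hu := hg.isUnit
    exact (hu.mul_right_eq_zero).1 ((hu.mul_left_eq_zero).1 h)
  · rw [hFmul, E_mul_mul_E, gramMatrix_self, one_smul]
  · rw [reTrace_apply, hFtr, E, Matrix.trace_single_mul, gramMatrix_self]
    simp
  · simp only [LinearMap.comp_apply, toMatrix_mul hm, hFmul, map_add, map_smul, map_sum]
  · have h := congrArg Complex.re (half_form_S_eq_trace hm i x)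
    rw [Complex.ofReal_re, ← toMatrix_S t ω i, ← htr, toMatrix_S] at h
    exact h
  · have h := congrArg Complex.re (form_eq_trace hm x y)
    rw [← htr] at h
    simp only [LinearMap.comp_apply, reTrace_apply]
    simpa [mul_add] using h

theorem form_self_nonneg (h0 : 0 ≤ t) (h1 : t ≤ 1 / 6) (x : M t) : 0 ≤ form t x x := by
  obtain ⟨f, P, ω, -, -, hf, -, -, -, -, -, hform⟩ := exists_hermitian_model h0 h1
  rw [hform]
  have := reTrace_sq_nonneg (hf x)
  have := Finset.sum_nonneg fun i (_ : i ∈ Finset.univ) => mul_self_nonneg (dCoord t i x)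
  linarith

theorem nortonInequality (h0 : 0 ≤ t) (h1 : t ≤ 1 / 6) : NortonInequality (form t) := by
  obtain ⟨f, P, ω, -, -, hf, hP, hPP, htr, hmul, hS, hform⟩ := exists_hermitian_model h0 h1
  intro u v
  -- The α and β are the D-coordinates of u and v; `dCoord_mul` with `hS` turns the coordinates of
  -- the products into the trace terms of this inequality.
  have h := norton_hermitian hP hPP htr (hf u) (hf v) (fun i => dCoord t i u)
    fun i => dCoord t i v
  have hsq : ∀ x, f (x * x) = f x * f x + ∑ i, (dCoord t i x * dCoord t i x) • P i := fun x => by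
    rw [hmul]; module
  rw [hform, hform, hsq, hsq, hmul]
  simp only [dCoord_mul, hS, ← two_mul, ← sq] at h ⊢
  simp only [mul_assoc] at h ⊢
  linarith

theorem exists_coords (x : M t) : ∃ s d r n : Fin 3 → ℝ,
    x = ∑ i, (s i • S t i + d i • D t i + r i • R t i + n i • N t i) := by
  let p : Submodule ℝ (M t) :=
    { carrier := {x | ∃ s d r n : Fin 3 → ℝ,
        x = ∑ i, (s i • S t i + d i • D t i + r i • R t i + n i • N t i)}
      add_mem' := by
        rintro _ _ ⟨s, d, r, n, rfl⟩ ⟨s', d', r', n', rfl⟩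
        refine ⟨s + s', d + d', r + r', n + n', ?_⟩
        rw [← Finset.sum_add_distrib]
        exact Finset.sum_congr rfl fun i _ => by simp only [Pi.add_apply]; module
      zero_mem' := ⟨0, 0, 0, 0, by simp⟩
      smul_mem' := by
        rintro k _ ⟨s, d, r, n, rfl⟩
        refine ⟨k • s, k • d, k • r, k • n, ?_⟩
        rw [Finset.smul_sum]
        exact Finset.sum_congr rfl fun i _ => by simp only [Pi.smul_apply, smul_eq_mul]; module }
  have hp : p = ⊤ := eq_top_of_mem
    (fun i => ⟨Pi.single i 1, 0, 0, 0, by simp [Pi.single_apply]⟩)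
    (fun i => ⟨0, Pi.single i 1, 0, 0, by simp [Pi.single_apply]⟩)
    (fun i => ⟨0, 0, Pi.single i 1, 0, by simp [Pi.single_apply]⟩)
    (fun i => ⟨0, 0, 0, Pi.single i 1, by simp [Pi.single_apply]⟩)
  exact (hp ▸ Submodule.mem_top : x ∈ p)

theorem dCoord_sum (s d r n : Fin 3 → ℝ) (i : Fin 3) :
    dCoord t i (∑ i, (s i • S t i + d i • D t i + r i • R t i + n i • N t i)) = d i := by
  simp [dCoord_S, dCoord_D, dCoord_R, dCoord_N]

/-- The diagonal entries give the `S` coordinates. Up to powers of ω, the off-diagonal pairs are r_i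
± n_i θ, which determine r_i and n_i because θ² = c² - 1 ≠ 0. -/
theorem eq_zero_of_toMatrix_eq_zero {ω : ℂ} (h : IsModel t ω) (hc : c t ^ 2 ≠ 1) {x : M t}
    (hx : toMatrix t ω x = 0) (hd : ∀ i, dCoord t i x = 0) : x = 0 := by
  obtain ⟨s, d, r, n, rfl⟩ := exists_coords x
  have h0 := h.1
  obtain ⟨θ, hθ⟩ : ∃ θ, θ = (ω ^ 3 - ω⁻¹ ^ 3) / 2 := ⟨_, rfl⟩
  have hN : ∀ i, toMatrix t ω (N t i) = edge (θ * ω) (-(θ * ω⁻¹)) i := fun i => by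
    rw [toMatrix_N, toMatrixN, hθ]
  have hθ0 : θ ≠ 0 := by
    intro h1
    apply hc
    have h2 : (c t : ℂ) ^ 2 - θ ^ 2 = 1 := by
      rw [h.2, hθ]; field_simp; ring
    rw [h1] at h2
    exact_mod_cast (by linear_combination h2 : (c t : ℂ) ^ 2 = 1)
  have hent : ∀ i j, ∑ k, (s k • E k k + r k • edge ω ω⁻¹ k
      + n k • edge (θ * ω) (-(θ * ω⁻¹)) k) i j = 0 := fun i j => by
    rw [← Matrix.sum_apply]
    have := congrFun (congrFun hx i) j
    simpa [toMatrix_S, toMatrix_D, toMatrix_R, hN, Matrix.sum_apply] using this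
  have hs : ∀ i, s i = 0 := fun i => by
    have := hent i i
    fin_cases i <;> simpa [Fin.sum_univ_three, E, edge] using this
  have hr1 : ∀ i, r i * ω + n i * (θ * ω) = 0 := fun i => by
    have := hent (i + 1) (i + 2)
    fin_cases i <;> simpa [Fin.sum_univ_three, E, edge] using this
  have hr2 : ∀ i, r i * ω⁻¹ - n i * (θ * ω⁻¹) = 0 := fun i => by
    have := hent (i + 2) (i + 1)
    fin_cases i <;> simpa [Fin.sum_univ_three, E, edge, sub_eq_add_neg] using this
  have hr3 : ∀ i, (r i : ℂ) + n i * θ = 0 := fun i =>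
    (mul_eq_zero.1 (by linear_combination hr1 i : ((r i : ℂ) + n i * θ) * ω = 0)).resolve_right h0
  have hr4 : ∀ i, (r i : ℂ) - n i * θ = 0 := fun i =>
    (mul_eq_zero.1 (by linear_combination hr2 i : ((r i : ℂ) - n i * θ) * ω⁻¹ = 0)).resolve_right
      (inv_ne_zero h0)
  have hr : ∀ i, r i = 0 := fun i => by
    exact_mod_cast (by linear_combination (hr3 i + hr4 i) / 2 : (r i : ℂ) = 0)
  have hn : ∀ i, n i = 0 := fun i => by
    have h1 : (n i : ℂ) * θ = 0 := by linear_combination (hr3 i - hr4 i) / 2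
    exact_mod_cast (mul_eq_zero.1 h1).resolve_right hθ0
  have hd' : ∀ i, d i = 0 := fun i => by rw [← hd i, dCoord_sum]
  simp [hs, hr, hn, hd']

theorem isPositiveDefinite_form (h0 : 0 < t) (h1 : t < 1 / 6) : IsPositiveDefinite (form t) := by
  refine ⟨form_symm t, fun x hx => lt_of_le_of_ne (form_self_nonneg h0.le h1.le x) fun h => hx ?_⟩
  obtain ⟨f, P, ω, hm, hf0, hf, -, -, -, -, -, hform⟩ := exists_hermitian_model h0.le h1.le
  rw [hform] at h
  have h2 := reTrace_sq_nonneg (hf x)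
  have h3 := Finset.sum_nonneg fun i (_ : i ∈ Finset.univ) => mul_self_nonneg (dCoord t i x)
  have h4 : ∑ i, dCoord t i x * dCoord t i x = 0 := by linarith
  rw [Finset.sum_eq_zero_iff_of_nonneg fun i _ => mul_self_nonneg _] at h4
  refine eq_zero_of_toMatrix_eq_zero hm ?_ (hf0 x (reTrace_sq_eq_zero (hf x) (by linarith)))
    fun i => mul_self_eq_zero.1 (h4 i (Finset.mem_univ i))
  -- c² - 1 = 24t(6t - 1), which is nonzero on the open interval.
  unfold c
  nlinarith

/-! ### The radical for `t = 0` and `t = 1 / 6` -/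

/-- The coordinate along `w i`. -/
def wCoord (i : Fin 3) : M t →ₗ[ℝ] ℝ := lift t (Pi.single (.w i) 1)

theorem wCoord_N (i j : Fin 3) : wCoord i (N t j) = if j = i then -12 else 12 := by
  obtain rfl | rfl | rfl := fin_three_cases i j <;>
  simp [N, D, S, wCoord, lift_e, Pi.single_apply, add_assoc]

theorem N_ne_zero (i : Fin 3) : N t i ≠ 0 := fun h => by
  have := wCoord_N (t := t) i i
  rw [h] at this
  simp at this

/-- The `w` coordinates of the three `N` form the invertible matrix 12(J - 2I), with J the all-ones
matrix. -/
theorem linearIndependent_N (t : ℝ) : LinearIndependent ℝ (N t) := by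
  rw [Fintype.linearIndependent_iff]
  intro g hg
  have h : ∀ k, ∑ i, g i * (if i = k then -12 else 12) = 0 := fun k => by
    have := congrArg (wCoord k) hg
    simpa only [map_sum, map_smul, wCoord_N, smul_eq_mul, map_zero] using this
  have h0 := h 0
  have h1 := h 1
  have h2 := h 2
  simp [Fin.sum_univ_three] at h0 h1 h2
  intro i
  fin_cases i <;> simp <;> linarith

theorem ker_form (hc : c t = 1 ∨ c t = -1) :
    LinearMap.ker (form t) = Submodule.span ℝ (Set.range (N t)) := by
  have hc2 : c t ^ 2 = 1 := by rcases hc with h | h <;> rw [h] <;> norm_num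
  apply le_antisymm
  · intro x hx
    obtain ⟨s, d, r, n, rfl⟩ := exists_coords x
    rw [LinearMap.mem_ker] at hx
    -- When c² = 1 the `N` coordinates drop out of all pairings. Pairing with `D` kills d, and
    -- pairing with `S` and `R` gives a linear system for s, r that is nonsingular for c = 1 and for
    -- c = -1.
    have h0 := fun y => (form_symm t y _).trans (LinearMap.congr_fun hx y)
    have hS := fun i => h0 (S t i)
    have hR := fun i => h0 (R t i)
    have hD := fun i => h0 (D t i)
    have hRS := fun i j => form_symm t (R t i) (S t j)
    have hRD := fun i j => form_symm t (R t i) (D t j)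
    have hDS := fun i j => form_symm t (D t i) (S t j)
    simp only [map_sum, map_add, map_smul, smul_eq_mul, LinearMap.zero_apply, hRS, hRD, hDS,
      form_S_S, form_S_D, form_S_R, form_S_N, form_D_D, form_D_R, form_D_N, form_R_R, form_R_N,
      hc2, Fin.sum_univ_three] at hS hR hD
    have hS0 := hS 0
    have hS1 := hS 1
    have hS2 := hS 2
    have hR0 := hR 0
    have hR1 := hR 1
    have hR2 := hR 2
    simp at hS0 hS1 hS2 hR0 hR1 hR2
    have hd : ∀ i, d i = 0 := fun i => by
      have := hD i
      fin_cases i <;> simpa using this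
    have hs : ∀ i, s i = 0 := fun i => by
      rcases hc with h | h <;> rw [h] at hS0 hS1 hS2 hR0 hR1 hR2 <;> fin_cases i <;> simp <;>
        linarith
    have hr : ∀ i, r i = 0 := fun i => by
      rcases hc with h | h <;> rw [h] at hS0 hS1 hS2 hR0 hR1 hR2 <;> fin_cases i <;> simp <;>
        linarith
    refine Submodule.sum_mem _ fun i _ => ?_
    rw [hs, hd, hr]
    simpa using Submodule.smul_mem _ _ (Submodule.subset_span (Set.mem_range_self i))
  · rw [Submodule.span_le]
    rintro _ ⟨i, rfl⟩
    rw [SetLike.mem_coe, LinearMap.mem_ker]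
    ext x
    obtain ⟨s, d, r, n, rfl⟩ := exists_coords x
    rw [form_symm]
    simp [form_S_N, form_D_N, form_R_N, form_N_N, hc2]

theorem finrank_radical (hB : IsFrobeniusForm (axes t) (form t)) (hc : c t = 1 ∨ c t = -1) :
    Module.finrank ℝ hB.radical.toSubmodule = 3 := by
  change Module.finrank ℝ (LinearMap.ker (form t)) = 3
  rw [ker_form hc, finrank_span_eq_card (linearIndependent_N t), Fintype.card_fin]

instance : Module.Finite ℝ (M t) := inferInstanceAs (Module.Finite ℝ (Label → ℝ))

theorem finrank_eq : Module.finrank ℝ (M t) = 12 := by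
  change Module.finrank ℝ (Label → ℝ) = 12
  rw [Module.finrank_fintype_fun_eq_card]
  rfl

theorem finrank_quotient_radical (hB : IsFrobeniusForm (axes t) (form t))
    (hc : c t = 1 ∨ c t = -1) : Module.finrank ℝ hB.radical.Quotient = 9 := by
  have h := hB.radical.toSubmodule.finrank_quotient_add_finrank
  rw [finrank_radical hB hc, finrank_eq] at h
  change Module.finrank ℝ (M t ⧸ hB.radical.toSubmodule) = 9
  omega

/-- If `M t` is a Majorana algebra, then `t` lies strictly between `0` and `1 / 6`. -/
theorem mem_Ioo_of_isMajoranaAlgebra (h : IsMajoranaAlgebra (axes t)) : 0 < t ∧ t < 1 / 6 := by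
  obtain ⟨hA, B, hB, hpos, -⟩ := h
  have hN := hpos.2 (N t 0) (N_ne_zero 0)
  -- Uniqueness replaces the unknown positive definite form by the given one, and ⟨N_0, N_0⟩ = 90t(1
  -- - 6t).
  rw [hA.frobeniusForm_unique hB (isFrobeniusForm t), form_N_N, if_pos rfl, c] at hN
  constructor <;> nlinarith

end M
end MonsterAxial

end

theorem theorem6p2 (t : ℝ) :
    MonsterAxial.IsPrimitiveAxialAlgebra MonsterAxial.monster (MonsterAxial.M.axes t) ∧
    ∃ hB : MonsterAxial.IsFrobeniusForm (MonsterAxial.M.axes t) (MonsterAxial.M.form t),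
      (MonsterAxial.IsMajoranaAlgebra (MonsterAxial.M.axes t) ↔ 0 < t ∧ t < 1 / 6) ∧
      (t = 0 ∨ t = 1 / 6 →
        Module.finrank ℝ hB.radical.toSubmodule = 3 ∧
        Module.finrank ℝ hB.radical.Quotient = 9 ∧
        MonsterAxial.IsMajoranaAlgebra (hB.radical.proj '' MonsterAxial.M.axes t)) := by
  have hA := MonsterAxial.M.isPrimitiveAxialAlgebra t
  have hB := MonsterAxial.M.isFrobeniusForm t
  refine ⟨hA, hB, ⟨MonsterAxial.M.mem_Ioo_of_isMajoranaAlgebra, fun h => ?_⟩, fun ht => ?_⟩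
  · exact ⟨hA, _, hB, MonsterAxial.M.isPositiveDefinite_form h.1 h.2,
      MonsterAxial.M.nortonInequality h.1.le h.2.le⟩
  -- The endpoints t = 0 and t = 1/6 are c = 1 and c = -1; the form is still positive semidefinite
  -- there.
  · have hc : MonsterAxial.M.c t = 1 ∨ MonsterAxial.M.c t = -1 := by
      rcases ht with rfl | rfl <;> norm_num [MonsterAxial.M.c]
    have h0 : 0 ≤ t := by rcases ht with rfl | rfl <;> norm_num
    have h1 : t ≤ 1 / 6 := by rcases ht with rfl | rfl <;> norm_num
    exact ⟨MonsterAxial.M.finrank_radical hB hc, MonsterAxial.M.finrank_quotient_radical hB hc,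
      hB.isMajoranaAlgebra_quotient hA (MonsterAxial.M.form_symm t)
        (MonsterAxial.M.form_self_nonneg h0 h1) (MonsterAxial.M.nortonInequality h0 h1)⟩
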